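/- Setting. There are $K$ nodes (arms), a measurable space $\mathcal S$ of network states and a finite set $\mathcal A$ of scheduling actions. For a node $k$, let $X_k:\mathcal S\to\{0,1\}$ be measurable, let $I_k:\mathcal A\to\{0,1\}$, and put $R_k(s,a)=X_k(s)I_k(a)$ (the reward). The states $S_1,S_2,\dots$ are i.i.d., $\overline x_k=\mathbb E[X_k(S_t)]$, and $I_{\max}=\max_{a\in\mathcal A}\sum_{k=1}^K I_k(a)$. The throughput requirements are $\chi_k>0$. Slater's condition is assumed for some $\gamma>0$: there is a probability distribution $\sigma^\gamma$ on $\mathcal A$ with $\overline x_k\sum_a\sigma^\gamma(a)I_k(a)\ge\chi_k+\gamma$ for all $k$. Benchmark. Let $T,W\ge1$ be integers with $W\mid T$. A causal policy is a sequence of random actions $A_1,\dots,A_T$ such that $A_t$ is independent of $S_\tau$ for each $\tau\ge t$; it is feasible if $\mathbb E\bigl[\frac1W\sum_{\tau=t-W+1}^tR_k(S_\tau,A_\tau)\bigr]\ge\chi_k$ for all $k$ and all $W\le t\le T$, and optimal if it is feasible and maximizes $\sum_{k=1}^K\sum_{t=1}^T\mathbb E[R_k(S_t,A_t)]$ among all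 feasible causal policies. If $\pi^*$ is an optimal causal policy and $\pi^*_t(a)$ is its probability of playing $a$ in slot $t$, then $\sigma^*(a)=\frac1T\sum_{t=1}^T\pi^*_t(a)$ is called an optimal static policy. The regret of a policy with actions $A_t$ is $\mathrm{Reg}_T=\sum_{k=1}^K\sum_{t=1}^T\mathbb E[R_k(S_t,A^*_t)-R_k(S_t,A_t)]$, where $A_t^*\sim\sigma^*$ is independent of $S_t$. Algorithm. Let $\eta>0$ and $0<\varepsilon\le\gamma/2$. For each node $k$ there is a first-come-first-served virtual queue of delivery requests. The $\ell$-th request, $\ell\ge1$, is generated in slot $\tau_k(\ell)$, where $\tau_k(0)=0$ and the interarrival times $\tau_k(\ell+1)-\tau_k(\ell)$, $\ell\ge0$, are geometric on $\{1,2,\dots\}$ with parameter $\chi_k+\varepsilon$, independent over $k$ and $\ell$ and of the states (that is, in each slot a request is generated with probability $\chi_k+\varepsilon$). Let $\ell^\to_{k,t}$ be one plus the number of requests of node $k$ that departed before slot $t$; this request departs in slot $t$ if and only if $R_k(S_t,A_t)=1$ and $\tau_k(\ell^\to_{k,t})\le t$. The head-of-line age is $Z^\to_{k,t}=\max\{t-\tau_k(\ell^\to_{k,t}),0\}$.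 Let $N_{k,t}$ be the number of slots before $t$ in which node $k$ was scheduled, $\widetilde x_{k,t}$ the average of the rewards of node $k$ in these slots, and $U_{k,t}=\min\{1,\widetilde x_{k,t}+\sqrt{3\log t/(2N_{k,t})}\}$ if $N_{k,t}>0$, $U_{k,t}=1$ if $N_{k,t}=0$. The age-based learning policy plays in each slot $t\in\{1,\dots,T\}$ an action $$A_t\in\arg\max_{a\in\mathcal A}\sum_{k=1}^K\bigl(\eta U_{k,t}+Z^\to_{k,t}\bigr)I_k(a)$$ that is a measurable function of the past actions, the past rewards $R_k(S_\tau,A_\tau)$, $\tau<t$, and the ages $Z^\to_{k,\tau}$, $\tau\le t$. Theorem. For all such $T,W$ an optimal static policy exists. For every optimal static policy and all $\eta>0$, $0<\varepsilon\le\gamma/2$, the regret of the age-based learning policy satisfies $$\mathrm{Reg}_T\le\frac{\varepsilon KT}{\gamma}+\frac T\eta\sum_{k=1}^K\frac1{\chi_k\overline x_k}+\sqrt{56\,K\,I_{\max}\,T\log T}+\frac{K\pi^2}3 .$$ Moreover this bound is $O(\varepsilon T+T/\eta+\sqrt{T\log T})$: there is a constant $C$, depending only on the model ($K$, $\mathcal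 A$, $X_k$, $I_k$, the law of the states, $\chi$, $\gamma$), such that for all $T\ge2$, $\eta>0$, $\varepsilon>0$ the right-hand side is at most $C\bigl(\varepsilon T+T/\eta+\sqrt{T\log T}\bigr)$. -/

import Mathlib

open MeasureTheory ProbabilityTheory

universe u v

noncomputable section

namespace AgeBandit

/-- A scheduling system with `K` nodes, network states `𝒮` and feasible scheduling actions `𝒜`.
`X k s = 1` if a packet of node `k` gets through in state `s`, `I k a = 1` if action `a`
schedules node `k`, and `law` is the (common) distribution of the network state. -/
structure Network (K : ℕ) (𝒮 𝒜 : Type u) [MeasurableSpace 𝒮] where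
  X : Fin K → 𝒮 → ℝ
  I : Fin K → 𝒜 → ℝ
  law : Measure 𝒮
  isProbabilityMeasure_law : IsProbabilityMeasure law
  measurable_X : ∀ k, Measurable (X k)
  X_binary : ∀ k s, X k s = 0 ∨ X k s = 1
  I_binary : ∀ k a, I k a = 0 ∨ I k a = 1

namespace Network

variable {K : ℕ} {𝒮 𝒜 : Type u} [MeasurableSpace 𝒮]

/-- The reward `R_k(s,a) = X_k(s) I_k(a)`. -/
def R (N : Network K 𝒮 𝒜) (k : Fin K) (s : 𝒮) (a : 𝒜) : ℝ := N.X k s * N.I k a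

/-- The channel rate of node `k`: the mean of `X_k(S_t)`. -/
def rate (N : Network K 𝒮 𝒜) (k : Fin K) : ℝ := ∫ s, N.X k s ∂N.law

/-- The largest number of nodes scheduled by one action (`𝒜` will be finite and nonempty). -/
def Imax (N : Network K 𝒮 𝒜) : ℝ := ⨆ a, ∑ k, N.I k a

/-- `S 0, S 1, …` is an i.i.d. sequence of network states (only `S 1, S 2, …` are ever used). -/
structure IsStateSequence (N : Network K 𝒮 𝒜) {Ω : Type v} [MeasurableSpace Ω]
    (P : Measure Ω) (S : ℕ → Ω → 𝒮) : Prop where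
  measurable : ∀ t, Measurable (S t)
  law_eq : ∀ t, P.map (S t) = N.law
  indep : iIndepFun S P

/-- The expected one-slot throughput of node `k` when the action is drawn from `σ`
independently of the network state, i.e. under the static policy `σ`. -/
def staticThroughput [MeasurableSpace 𝒜] (N : Network K 𝒮 𝒜) (σ : PMF 𝒜) (k : Fin K) : ℝ :=
  ∫ z, N.R k z.1 z.2 ∂(N.law.prod σ.toMeasure)

end Network

/-- A causal policy over the time slots `1, …, T`, on some probability space that carries the
network states: the action in slot `t` is independent of every present and future state. -/
structure CausalPolicy {K : ℕ} {𝒮 𝒜 : Type u} [MeasurableSpace 𝒮] [MeasurableSpace 𝒜]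
    (N : Network K 𝒮 𝒜) (T : ℕ) where
  Ω : Type u
  mΩ : MeasurableSpace Ω
  P : Measure Ω
  isProbabilityMeasure_P : IsProbabilityMeasure P
  S : ℕ → Ω → 𝒮
  A : ℕ → Ω → 𝒜
  isStateSequence : N.IsStateSequence P S
  measurable_A : ∀ t ∈ Finset.Icc 1 T, Measurable (A t)
  indep : ∀ t ∈ Finset.Icc 1 T, ∀ s, t ≤ s → IndepFun (A t) (S s) P

namespace CausalPolicy

variable {K : ℕ} {𝒮 𝒜 : Type u} [MeasurableSpace 𝒮] [MeasurableSpace 𝒜]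
  {N : Network K 𝒮 𝒜} {T : ℕ}

/-- The probability `π_t(a)` that the policy plays `a` in slot `t`. -/
def prob (π : CausalPolicy N T) (t : ℕ) (a : 𝒜) : ℝ :=
  letI := π.mΩ
  π.P.real {ω | π.A t ω = a}

/-- The cumulative expected reward up to time `T`. -/
def value (π : CausalPolicy N T) : ℝ :=
  letI := π.mΩ
  ∑ k, ∑ t ∈ Finset.Icc 1 T, ∫ ω, N.R k (π.S t ω) (π.A t ω) ∂π.P

/-- The expected throughput of node `k` over the window `t - W + 1, …, t`. -/
def windowThroughput (π : CausalPolicy N T) (W : ℕ) (k : Fin K) (t : ℕ) : ℝ :=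
  letI := π.mΩ
  ∫ ω, (1 / (W : ℝ)) * ∑ s ∈ Finset.Icc (t + 1 - W) t, N.R k (π.S s ω) (π.A s ω) ∂π.P

/-- The short-term throughput constraints of the online learning problem. -/
def IsFeasible (π : CausalPolicy N T) (χ : Fin K → ℝ) (W : ℕ) : Prop :=
  ∀ k, ∀ t ∈ Finset.Icc W T, χ k ≤ π.windowThroughput W k t

/-- `π` maximizes the cumulative expected reward among the feasible causal policies. -/
def IsOptimal (π : CausalPolicy N T) (χ : Fin K → ℝ) (W : ℕ) : Prop :=
  π.IsFeasible χ W ∧ ∀ π' : CausalPolicy N T, π'.IsFeasible χ W → π'.value ≤ π.value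

end CausalPolicy

section Algorithm

variable {K : ℕ} {𝒮 𝒜 : Type u} [MeasurableSpace 𝒮]

/-- `σ` is the optimal static policy: the time average of an optimal causal policy. -/
def IsOptimalStatic [MeasurableSpace 𝒜] (N : Network K 𝒮 𝒜) (χ : Fin K → ℝ) (T W : ℕ)
    (σ : PMF 𝒜) : Prop :=
  ∃ π : CausalPolicy N T, π.IsOptimal χ W ∧
    ∀ a, (σ a).toReal = (1 / (T : ℝ)) * ∑ t ∈ Finset.Icc 1 T, π.prob t a

/-- Generation time of the `ℓ`-th delivery request (`ℓ = 1, 2, …`), from the interarrival times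
`g 0, g 1, …`; by convention it is `0` for `ℓ = 0`. -/
def arrivalTime (g : ℕ → ℕ) (ℓ : ℕ) : ℕ := ∑ j ∈ Finset.range ℓ, g j

/-- Index of the next-to-depart delivery request at the beginning of slot `t`, i.e. one plus the
number of departures before `t`. In slot `t ≥ 1` this request departs if and only if the reward
`r t` is one and the request was generated by time `t`. -/
def nextToDepart (g : ℕ → ℕ) (r : ℕ → ℝ) : ℕ → ℕ
  | 0 => 1
  | t + 1 =>
    if 1 ≤ t ∧ r t = 1 ∧ arrivalTime g (nextToDepart g r t) ≤ t then nextToDepart g r t + 1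
    else nextToDepart g r t

/-- The head-of-line age: the positive part of the age of the next-to-depart request
(subtraction of natural numbers is truncated at zero). -/
def headOfLineAge (g : ℕ → ℕ) (r : ℕ → ℝ) (t : ℕ) : ℕ :=
  t - arrivalTime g (nextToDepart g r t)

variable {Ω : Type v}

/-- The head-of-line age of node `k` in slot `t` when the states are `S`, the actions are `A`
and the interarrival times of delivery requests are `G`. -/
def age (N : Network K 𝒮 𝒜) (S : ℕ → Ω → 𝒮) (G : Fin K → ℕ → Ω → ℕ) (A : ℕ → Ω → 𝒜)
    (k : Fin K) (t : ℕ) (ω : Ω) : ℕ :=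
  headOfLineAge (fun ℓ => G k ℓ ω) (fun s => N.R k (S s ω) (A s ω)) t

/-- How often node `k` was scheduled before slot `t`. -/
def playCount (N : Network K 𝒮 𝒜) (A : ℕ → Ω → 𝒜) (k : Fin K) (t : ℕ) (ω : Ω) : ℝ :=
  ∑ s ∈ Finset.Ico 1 t, N.I k (A s ω)

/-- The empirical mean of the rewards of node `k` over the slots before `t` in which it was
scheduled (the reward vanishes in the other slots; the value is `0` if there are none). -/
def empiricalMean (N : Network K 𝒮 𝒜) (S : ℕ → Ω → 𝒮) (A : ℕ → Ω → 𝒜) (k : Fin K) (t : ℕ)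
    (ω : Ω) : ℝ :=
  (∑ s ∈ Finset.Ico 1 t, N.R k (S s ω) (A s ω)) / playCount N A k t ω

/-- The truncated UCB estimate of the channel rate of node `k`. -/
def ucb (N : Network K 𝒮 𝒜) (S : ℕ → Ω → 𝒮) (A : ℕ → Ω → 𝒜) (k : Fin K) (t : ℕ) (ω : Ω) : ℝ :=
  if playCount N A k t ω = 0 then 1
  else min 1 (empiricalMean N S A k t ω
    + Real.sqrt (3 * Real.log t / (2 * playCount N A k t ω)))

/-- The age-augmented history at the beginning of slot `t`: the σ-algebra generated by the past
actions and rewards and by the past and present head-of-line ages. -/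
def ageHistory [MeasurableSpace 𝒜] (N : Network K 𝒮 𝒜) (S : ℕ → Ω → 𝒮)
    (G : Fin K → ℕ → Ω → ℕ) (A : ℕ → Ω → 𝒜) (t : ℕ) : MeasurableSpace Ω :=
  (⨆ s ∈ Finset.Ico 1 t, MeasurableSpace.comap (A s) inferInstance) ⊔
  (⨆ k, ⨆ s ∈ Finset.Ico 1 t,
    MeasurableSpace.comap (fun ω => N.R k (S s ω) (A s ω)) inferInstance) ⊔
  (⨆ k, ⨆ s ∈ Finset.Icc 1 t, MeasurableSpace.comap (age N S G A k s) inferInstance)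

/-- `G k ℓ` is the interarrival time between the delivery requests `ℓ` and `ℓ + 1` of node `k`.
These are independent of each other and of the network states, and the ones of node `k` are
geometric on `{1, 2, …}` with parameter `p k`; equivalently, a request is generated in every slot
with probability `p k`, independently over slots and nodes. -/
structure IsArrivalSequence [MeasurableSpace Ω] (P : Measure Ω) (S : ℕ → Ω → 𝒮)
    (p : Fin K → ℝ) (G : Fin K → ℕ → Ω → ℕ) : Prop where
  measurable : ∀ k ℓ, Measurable (G k ℓ)
  geometric : ∀ k ℓ n, P {ω | G k ℓ ω = n + 1} = ENNReal.ofReal ((1 - p k) ^ n * p k)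
  indep : iIndepFun (fun i : Fin K × ℕ => G i.1 i.2) P
  indep_states : IndepFun (fun ω t => S t ω) (fun ω (i : Fin K × ℕ) => G i.1 i.2 ω) P

/-- A run of the age-based bandit learning policy up to time `T` with parameters `η` and `ε`:
in every slot the action is a measurable function of the age-augmented history (ties are broken in
any such way) and maximizes the weight `∑ k, (η * U_{k,t} + Z_{k,t}) * I_k(a)`. -/
structure IsAgeBasedRun [MeasurableSpace 𝒜] [MeasurableSpace Ω] (N : Network K 𝒮 𝒜)
    (χ : Fin K → ℝ) (η ε : ℝ) (T : ℕ) (P : Measure Ω) (S : ℕ → Ω → 𝒮)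
    (G : Fin K → ℕ → Ω → ℕ) (A : ℕ → Ω → 𝒜) : Prop where
  states : N.IsStateSequence P S
  arrivals : IsArrivalSequence P S (fun k => χ k + ε) G
  history : ∀ t ∈ Finset.Icc 1 T, Measurable[ageHistory N S G A t] (A t)
  maximal : ∀ t ∈ Finset.Icc 1 T, ∀ ω a,
    ∑ k, (η * ucb N S A k t ω + age N S G A k t ω) * N.I k a ≤
      ∑ k, (η * ucb N S A k t ω + age N S G A k t ω) * N.I k (A t ω)

/-- The regret up to time `T` of the actions `A` against the static policy `σ`. -/
def regret [MeasurableSpace 𝒜] [MeasurableSpace Ω] (N : Network K 𝒮 𝒜) (P : Measure Ω)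
    (S : ℕ → Ω → 𝒮) (A : ℕ → Ω → 𝒜) (σ : PMF 𝒜) (T : ℕ) : ℝ :=
  ∑ k, ∑ t ∈ Finset.Icc 1 T,
    (N.staticThroughput σ k - ∫ ω, N.R k (S t ω) (A t ω) ∂P)

/-- The regret bound. -/
def regretBound (N : Network K 𝒮 𝒜) (χ : Fin K → ℝ) (γ η ε : ℝ) (T : ℕ) : ℝ :=
  ε * K * T / γ + T / η * ∑ k, 1 / (χ k * N.rate k)
    + Real.sqrt (56 * K * N.Imax * T * Real.log T) + K * Real.pi ^ 2 / 3

end Algorithm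

end AgeBandit

end

/-! The proof is a drift-plus-penalty argument combined with UCB estimates. With `δ = ε/γ`, the
mixture `w = (1-δ)σ* + δσ^γ` has throughput at least `χ k + ε` at every node, and replacing `σ*` by
`w` costs at most `δ` per node and slot, hence `εKT/γ` in total.

Put `q k = ∑ a, w a * I k a`. The played action maximizes the weights `ηU + Z`, so `∑ k, (ηU + Z)(q
- I) ≤ 0` on every path. Therefore `η ∑ x̄(q - I) ≤ η ∑ (x̄ - U)(q - I) + ∑ Z(I - q)`, and the two
sums on the right are bounded separately (`sum_rate_mul_sub_le`).

Ages: a departure changes `Z` to `(Z + 1 - g)⁺`, where `g` is the interarrival time behind the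
departing request. What has happened up to slot `t` involves the interarrival times of this node
only before the next-to-depart index (`exists_measurable_stoppedSpace`), so a Wald identity
(`integral_mul_stopped`) replaces `g` by its mean `1/p`, where `p = χ k + ε`. Telescoping `E Z²`
gives `∑ E[Z I] ≤ (p/x̄) ∑ E Z + T/(p x̄)` (`sum_integral_age_mul_le`). Since `q ≥ p/x̄`, the age
term is at most `T/(p x̄)` per node, and division by `η` yields the second term of the bound.

Estimates: outside the deviation events `x̄ ≤ U ≤ x̄ + √(6 log t / n)` after `n ≥ 1` plays. An
exponential supermartingale gives each event probability at most `t⁻²`; the two sides together cost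
`2 · π²/6` per node. The remaining confidence widths are summed along each path by `1/√n ≤ 2(√n -
√(n-1))` and Cauchy–Schwarz over the nodes.

Existence of the benchmark is a compactness argument: rewards and constraints see only the marginals
of the actions, and averaging over time turns a feasible policy into a feasible point of the simplex
(`exists_isOptimalStatic`). -/

namespace AgeBandit

/-! ### Independence of joined σ-algebras. -/

section Independence

variable {Ω : Type*} {mΩ : MeasurableSpace Ω} {P : Measure Ω} [IsProbabilityMeasure P]

/-- If `c` is independent of `a ⊔ b` and `a` is independent of `b`, then `c ⊔ a` is
independent of `b`. -/
lemma indep_sup_left_of_indep_sup {a b c : MeasurableSpace Ω} (ha : a ≤ mΩ) (hb : b ≤ mΩ)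
    (hc : c ≤ mΩ) (hcab : Indep c (a ⊔ b) P) (hab : Indep a b P) : Indep (c ⊔ a) b P := by
  -- The sets `C ∩ A` form a π-system generating `c ⊔ a`, and on them the product rule follows by
  -- splitting off `C` first.
  refine IndepSets.indep (p1 := {s | ∃ C A, MeasurableSet[c] C ∧ MeasurableSet[a] A ∧ s = C ∩ A})
    (p2 := {s | MeasurableSet[b] s}) (sup_le hc ha) hb ?_ (@MeasurableSpace.isPiSystem_measurableSet _ b) ?_
    (@MeasurableSpace.generateFrom_measurableSet _ b).symm ?_
  · rintro _ ⟨C, A, hC, hA, rfl⟩ _ ⟨C', A', hC', hA', rfl⟩ -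
    exact ⟨C ∩ C', A ∩ A', hC.inter hC', hA.inter hA', Set.inter_inter_inter_comm _ _ _ _⟩
  · apply le_antisymm
    · refine sup_le (fun s hs => ?_) (fun s hs => ?_)
      · exact MeasurableSpace.measurableSet_generateFrom ⟨s, Set.univ, hs, MeasurableSet.univ, by simp⟩
      · exact MeasurableSpace.measurableSet_generateFrom ⟨Set.univ, s, MeasurableSet.univ, hs, by simp⟩
    · refine MeasurableSpace.generateFrom_le ?_
      rintro _ ⟨C, A, hC, hA, rfl⟩
      exact ((le_sup_left : c ≤ c ⊔ a) _ hC).inter ((le_sup_right : a ≤ c ⊔ a) _ hA)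
  · rw [IndepSets_iff]
    rintro _ B ⟨C, A, hC, hA, rfl⟩ hB
    rw [Indep_iff] at hcab hab
    have hA' : MeasurableSet[a ⊔ b] A := (le_sup_left : a ≤ a ⊔ b) _ hA
    have hB' : MeasurableSet[a ⊔ b] B := (le_sup_right : b ≤ a ⊔ b) _ hB
    rw [Set.inter_assoc, hcab C _ hC (hA'.inter hB'), hcab C _ hC hA', hab A B hA hB, mul_assoc]

omit [IsProbabilityMeasure P] in
lemma indepFun_of_indep {m m' : MeasurableSpace Ω} {α β : Type*} [MeasurableSpace α]
    [MeasurableSpace β] {f : Ω → α} {g : Ω → β} (h : Indep m m' P) (hf : Measurable[m] f)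
    (hg : Measurable[m'] g) : IndepFun f g P :=
  (IndepFun_iff_Indep f g P).2 (indep_of_indep_of_le h hf.comap_le hg.comap_le)

end Independence

/-! ### Moments of the geometric law on `{1, 2, …}`. -/

section Geometric

variable {Ω : Type*} [MeasurableSpace Ω] {P : Measure Ω} [IsProbabilityMeasure P]
  {g : Ω → ℕ} {p : ℝ}

lemma hasSum_geometric_weight (hp : 0 < p) (hp' : p ≤ 1) :
    HasSum (fun n : ℕ => (1 - p) ^ n * p) 1 := by
  have h := (hasSum_geometric_of_lt_one (r := 1 - p) (by linarith) (by linarith)).mul_right p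
  rwa [sub_sub_cancel, inv_mul_cancel₀ hp.ne'] at h

/-- The prescribed masses on `1, 2, …` already sum to one, so the value `0` has probability zero. -/
lemma ae_one_le_of_geometric (hg : Measurable g) (hp : 0 < p) (hp' : p ≤ 1)
    (h : ∀ n, P {ω | g ω = n + 1} = ENNReal.ofReal ((1 - p) ^ n * p)) : ∀ᵐ ω ∂P, 1 ≤ g ω := by
  have hm : ∀ n : ℕ, MeasurableSet {ω | g ω = n + 1} := fun n => hg (measurableSet_singleton (n + 1))
  have hU : {ω | 1 ≤ g ω} = ⋃ n : ℕ, {ω | g ω = n + 1} := by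
    ext ω
    simp only [Set.mem_ofPred_eq, Set.mem_iUnion]
    exact ⟨fun h => ⟨g ω - 1, by omega⟩, fun ⟨n, hn⟩ => by omega⟩
  have hmU : MeasurableSet {ω | 1 ≤ g ω} := hU ▸ MeasurableSet.iUnion hm
  rw [ae_iff]
  have h1 : P {ω | 1 ≤ g ω} = 1 := by
    rw [hU, measure_iUnion (fun i j hij => Set.disjoint_left.2 fun ω hi hj => hij (by
      simp only [Set.mem_ofPred_eq] at hi hj; omega)) hm]
    simp_rw [h]
    rw [← ENNReal.ofReal_tsum_of_nonneg
      (fun n => mul_nonneg (pow_nonneg (by linarith) n) hp.le) (hasSum_geometric_weight hp hp').summable,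
      (hasSum_geometric_weight hp hp').tsum_eq, ENNReal.ofReal_one]
  exact (prob_compl_eq_zero_iff hmU).2 h1

/-- `geometricMeasure` counts failures from `0`, hence the shift by one; truncated subtraction is
harmless because `g ≥ 1` almost surely. -/
lemma map_sub_one_eq_geometricMeasure (hg : Measurable g) (hp : 0 < p) (hp' : p ≤ 1)
    (h : ∀ n, P {ω | g ω = n + 1} = ENNReal.ofReal ((1 - p) ^ n * p)) :
    P.map (fun ω => g ω - 1) = geometricMeasure ⟨p, hp.le, hp'⟩ := by
  refine Measure.ext_of_singleton fun n => ?_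
  rw [geometricMeasure_singleton (by simpa [← Subtype.coe_ne_coe] using hp.ne'),
    Measure.map_apply (by fun_prop) (measurableSet_singleton n), ← h n]
  refine measure_congr ?_
  filter_upwards [ae_one_le_of_geometric hg hp hp' h] with ω hω
  apply propext
  change g ω - 1 = n ↔ g ω = n + 1
  omega

lemma hasSum_geometric_mean (hp : 0 < p) (hp' : p ≤ 1) :
    HasSum (fun n : ℕ => (1 - p) ^ n * p * ((n : ℝ) + 1)) (1 / p) := by
  have h := (hasSum_choose_mul_geometric_of_norm_lt_one 1 (r := 1 - p)
    (by rw [Real.norm_eq_abs, abs_lt]; constructor <;> linarith)).mul_right p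
  rw [show 1 / (1 - (1 - p)) ^ (1 + 1) * p = 1 / p by rw [sub_sub_cancel]; field_simp] at h
  have e : (fun n : ℕ => (1 - p) ^ n * p * ((n : ℝ) + 1)) =
      fun n => ((n + 1).choose 1 : ℝ) * (1 - p) ^ n * p := by
    funext n
    simp only [Nat.choose_one_right]
    push_cast
    ring
  exact e ▸ h

lemma hasSum_geometric_factorial_moment (hp : 0 < p) (hp' : p ≤ 1) :
    HasSum (fun n : ℕ => (1 - p) ^ n * p * (((n : ℝ) + 1) * (n + 2))) (2 / p ^ 2) := by
  have h := (hasSum_choose_mul_geometric_of_norm_lt_one 2 (r := 1 - p)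
    (by rw [Real.norm_eq_abs, abs_lt]; constructor <;> linarith)).mul_right (2 * p)
  rw [show 1 / (1 - (1 - p)) ^ (2 + 1) * (2 * p) = 2 / p ^ 2 by
    rw [sub_sub_cancel]; field_simp] at h
  have e : (fun n : ℕ => (1 - p) ^ n * p * (((n : ℝ) + 1) * (n + 2))) =
      fun n => ((n + 2).choose 2 : ℝ) * (1 - p) ^ n * (2 * p) := by
    funext n
    simp only [Nat.cast_choose_two]
    push_cast
    ring
  exact e ▸ h

lemma integral_comp_of_geometric (hg : Measurable g) (hp : 0 < p) (hp' : p ≤ 1)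
    (h : ∀ n, P {ω | g ω = n + 1} = ENNReal.ofReal ((1 - p) ^ n * p)) {f : ℕ → ℝ} {s : ℝ}
    (hf : ∀ n, 0 ≤ f n) (hs : HasSum (fun n : ℕ => (1 - p) ^ n * p * f (n + 1)) s) :
    Integrable (fun ω => f (g ω)) P ∧ ∫ ω, f (g ω) ∂P = s := by
  have hq : (⟨p, hp.le, hp'⟩ : unitInterval) ≠ 0 := by
    simpa [← Subtype.coe_ne_coe] using hp.ne'
  have hI : Integrable (fun n => f (n + 1)) (geometricMeasure ⟨p, hp.le, hp'⟩) := by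
    rw [integrable_geometricMeasure_iff hq]
    simpa [abs_of_nonneg (hf _)] using hs.summable
  have hE : (fun ω => f (g ω - 1 + 1)) =ᵐ[P] fun ω => f (g ω) := by
    filter_upwards [ae_one_le_of_geometric hg hp hp' h] with ω hω
    rw [Nat.sub_add_cancel hω]
  have hmap := map_sub_one_eq_geometricMeasure hg hp hp' h
  have hg' : Measurable fun ω => g ω - 1 := by fun_prop
  have hsm : ∀ μ : Measure ℕ, AEStronglyMeasurable (fun n => f (n + 1)) μ := fun μ =>
    (measurable_of_countable _).aestronglyMeasurable
  refine ⟨?_, ?_⟩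
  · rw [← hmap] at hI
    exact ((integrable_map_measure (hsm _) hg'.aemeasurable).1 hI).congr hE
  · rw [← integral_congr_ae hE,
      ← integral_map (φ := fun ω => g ω - 1) (f := fun n => f (n + 1)) hg'.aemeasurable (hsm _), hmap]
    exact (hasSum_integral_geometricMeasure hq hI).unique (by simpa using hs)

lemma integral_of_geometric (hg : Measurable g) (hp : 0 < p) (hp' : p ≤ 1)
    (h : ∀ n, P {ω | g ω = n + 1} = ENNReal.ofReal ((1 - p) ^ n * p)) :
    Integrable (fun ω => (g ω : ℝ)) P ∧ ∫ ω, (g ω : ℝ) ∂P = 1 / p :=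
  integral_comp_of_geometric (f := fun n => (n : ℝ)) hg hp hp' h (fun n => by positivity)
    (by simpa using hasSum_geometric_mean hp hp')

lemma integral_sq_of_geometric (hg : Measurable g) (hp : 0 < p) (hp' : p ≤ 1)
    (h : ∀ n, P {ω | g ω = n + 1} = ENNReal.ofReal ((1 - p) ^ n * p)) :
    Integrable (fun ω => (g ω : ℝ) ^ 2) P ∧ ∫ ω, (g ω : ℝ) ^ 2 ∂P = 2 / p ^ 2 - 1 / p := by
  refine integral_comp_of_geometric (f := fun n => (n : ℝ) ^ 2) hg hp hp' h
    (fun n => by positivity) ?_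
  -- The second moment comes from `(n+1)² = (n+1)(n+2) - (n+1)`.
  have e : (fun n : ℕ => (1 - p) ^ n * p * ((n + 1 : ℕ) : ℝ) ^ 2) = fun n : ℕ =>
      (1 - p) ^ n * p * (((n : ℝ) + 1) * (n + 2)) - (1 - p) ^ n * p * ((n : ℝ) + 1) := by
    funext n
    push_cast
    ring
  exact e ▸ (hasSum_geometric_factorial_moment hp hp').sub (hasSum_geometric_mean hp hp')

end Geometric

end AgeBandit

namespace AgeBandit

/-! ### The σ-algebra stopped at a random index. -/

section StoppedSpace

variable {Ω : Type*} {F : ℕ → MeasurableSpace Ω} {ℓ : Ω → ℕ}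

/-- The σ-algebra of the events that, for each `j`, are decided by `F j` on `{ℓ = j}`. -/
@[reducible]
def stoppedSpace (F : ℕ → MeasurableSpace Ω) (ℓ : Ω → ℕ)
    (hℓ : ∀ j, MeasurableSet[F j] {ω | ℓ ω = j}) : MeasurableSpace Ω where
  MeasurableSet' B := ∀ j, MeasurableSet[F j] (B ∩ {ω | ℓ ω = j})
  measurableSet_empty j := by simp
  measurableSet_compl B hB j := by
    have : Bᶜ ∩ {ω | ℓ ω = j} = {ω | ℓ ω = j} \ (B ∩ {ω | ℓ ω = j}) := by
      ext ω; simp; tauto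
    rw [this]
    exact (hℓ j).diff (hB j)
  measurableSet_iUnion B hB j := by
    rw [Set.iUnion_inter]
    exact MeasurableSet.iUnion fun i => hB i j

variable {hℓ : ∀ j, MeasurableSet[F j] {ω | ℓ ω = j}}

lemma measurable_stoppedSpace_of_forall {α : Type*} [MeasurableSpace α] {h : ℕ → Ω → α}
    (hh : ∀ j, Measurable[F j] (h j)) :
    Measurable[stoppedSpace F ℓ hℓ] (fun ω => h (ℓ ω) ω) := by
  intro B hB j
  have : (fun ω => h (ℓ ω) ω) ⁻¹' B ∩ {ω | ℓ ω = j} = h j ⁻¹' B ∩ {ω | ℓ ω = j} := by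
    ext ω
    simp only [Set.mem_inter_iff, Set.mem_preimage, Set.mem_ofPred_eq]
    exact and_congr_left fun e => by rw [e]
  rw [this]
  exact (hh j hB).inter (hℓ j)

lemma measurable_ite_of_stoppedSpace {f : Ω → ℝ} (hf : Measurable[stoppedSpace F ℓ hℓ] f)
    (j : ℕ) : Measurable[F j] (fun ω => if ℓ ω = j then f ω else 0) := by
  intro B hB
  have : (fun ω => if ℓ ω = j then f ω else 0) ⁻¹' B =
      (f ⁻¹' B ∩ {ω | ℓ ω = j}) ∪ ({ω | ℓ ω = j}ᶜ ∩ {_ω | (0 : ℝ) ∈ B}) := by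
    ext ω
    by_cases h : ℓ ω = j <;> simp [h]
  rw [this]
  exact (hf hB j).union ((hℓ j).compl.inter (MeasurableSet.const _))

/-- The new index equals `i + 1` either by staying there off `D` or by moving from `i` on `D`, and
`F i ≤ F (i + 1)`. With `B = univ` this makes the advanced index admissible; with general `B` it
shows that the stopped σ-algebra grows. -/
lemma measurableSet_advance (hF : Monotone F) {D : Set Ω}
    (hD : MeasurableSet[stoppedSpace F ℓ hℓ] D) [DecidablePred (· ∈ D)] {B : Set Ω}
    (hB : MeasurableSet[stoppedSpace F ℓ hℓ] B) (j : ℕ) :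
    MeasurableSet[F j] (B ∩ {ω | (if ω ∈ D then ℓ ω + 1 else ℓ ω) = j}) := by
  have h1 : MeasurableSet[F j] (B ∩ Dᶜ ∩ {ω | ℓ ω = j}) := hB.inter hD.compl j
  cases j with
  | zero =>
    have : B ∩ {ω | (if ω ∈ D then ℓ ω + 1 else ℓ ω) = 0} = B ∩ Dᶜ ∩ {ω | ℓ ω = 0} := by
      ext ω
      by_cases h : ω ∈ D <;> simp [h]
    rwa [this]
  | succ i =>
    have h2 : MeasurableSet[F (i + 1)] (B ∩ D ∩ {ω | ℓ ω = i}) :=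
      hF (Nat.le_succ i) _ (hB.inter hD i)
    have : B ∩ {ω | (if ω ∈ D then ℓ ω + 1 else ℓ ω) = i + 1} =
        (B ∩ Dᶜ ∩ {ω | ℓ ω = i + 1}) ∪ (B ∩ D ∩ {ω | ℓ ω = i}) := by
      ext ω
      by_cases h : ω ∈ D <;> simp [h]
    rw [this]
    exact h1.union h2

end StoppedSpace

/-! ### Measurability of the virtual queue. -/

section Queue

variable {Ω : Type*} [MeasurableSpace Ω] {g : ℕ → Ω → ℕ} {r : ℕ → Ω → ℝ}

lemma measurable_arrivalTime {n : ℕ} (hg : ∀ i < n, Measurable (g i)) :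
    Measurable fun ω => arrivalTime (fun i => g i ω) n :=
  Finset.measurable_sum _ fun i hi => hg i (Finset.mem_range.1 hi)

lemma measurable_arrivalTime_comp (hg : ∀ i, Measurable (g i)) {ℓ : Ω → ℕ} (hℓ : Measurable ℓ) :
    Measurable fun ω => arrivalTime (fun i => g i ω) (ℓ ω) := by
  have : Measurable fun x : ℕ × Ω => arrivalTime (fun i => g i x.2) x.1 :=
    measurable_from_prod_countable_right fun n => measurable_arrivalTime fun i _ => hg i
  exact this.comp (hℓ.prodMk measurable_id)

lemma measurable_nextToDepart (hg : ∀ i, Measurable (g i)) (t : ℕ)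
    (hr : ∀ s, 1 ≤ s → s < t → Measurable (r s)) :
    Measurable fun ω => nextToDepart (fun i => g i ω) (fun s => r s ω) t := by
  induction t with
  | zero => exact measurable_const
  | succ t ih =>
    have h := ih fun s h1 h2 => hr s h1 (h2.trans t.lt_succ_self)
    simp only [nextToDepart]
    by_cases ht : 1 ≤ t
    · simp only [ht, true_and]
      refine Measurable.ite ?_ (h.add_const 1) h
      exact (hr t ht t.lt_succ_self (measurableSet_singleton 1)).inter
        (measurableSet_le (measurable_arrivalTime_comp hg h) measurable_const)
    · simpa [ht] using h

lemma measurable_headOfLineAge (hg : ∀ i, Measurable (g i)) (t : ℕ)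
    (hr : ∀ s, 1 ≤ s → s < t → Measurable (r s)) :
    Measurable fun ω => headOfLineAge (fun i => g i ω) (fun s => r s ω) t :=
  measurable_const.sub (measurable_arrivalTime_comp hg (measurable_nextToDepart hg t hr))

end Queue

/-! ### Which randomness determines the actions and ages. -/

section Run

variable {K : ℕ} {𝒮 𝒜 : Type u} [MeasurableSpace 𝒮] [MeasurableSpace 𝒜]
  [MeasurableSingletonClass 𝒜] [Fintype 𝒜] {N : Network K 𝒮 𝒜} {Ω : Type v}
  {S : ℕ → Ω → 𝒮} {G : Fin K → ℕ → Ω → ℕ} {A : ℕ → Ω → 𝒜}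

lemma Network.measurable_reward [MeasurableSpace Ω] (N : Network K 𝒮 𝒜) (k : Fin K) {s : Ω → 𝒮}
    {a : Ω → 𝒜} (hs : Measurable s) (ha : Measurable a) : Measurable fun ω => N.R k (s ω) (a ω) :=
  ((N.measurable_X k).comp hs).mul ((measurable_of_finite (N.I k)).comp ha)

lemma ageHistory_le {m : MeasurableSpace Ω} {t : ℕ}
    (hS : ∀ s ∈ Finset.Ico 1 t, Measurable[m] (S s)) (hA : ∀ s ∈ Finset.Ico 1 t, Measurable[m] (A s))
    (hZ : ∀ k, ∀ s ∈ Finset.Icc 1 t, Measurable[m] (age N S G A k s)) :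
    ageHistory N S G A t ≤ m := by
  refine sup_le (sup_le ?_ ?_) ?_
  · exact iSup₂_le fun s hs => (hA s hs).comap_le
  · exact iSup_le fun k => iSup₂_le fun s hs => (N.measurable_reward k (hS s hs) (hA s hs)).comap_le
  · exact iSup_le fun k => iSup₂_le fun s hs => (hZ k s hs).comap_le

variable {T : ℕ}

/-- The actions and ages up to time `t` are determined by the states before `t` and the
arrivals. -/
lemma measurable_age_and_action {m : MeasurableSpace Ω} {t : ℕ}
    (hist : ∀ t ∈ Finset.Icc 1 T, Measurable[ageHistory N S G A t] (A t))
    (hS : ∀ s ∈ Finset.Ico 1 t, Measurable[m] (S s)) (hG : ∀ k i, Measurable[m] (G k i)) :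
    -- Ages are followed one slot beyond the last action because the last drift step compares slots
    -- `T` and `T + 1`.
    ∀ s, 1 ≤ s → s ≤ t → s ≤ T + 1 →
      (∀ k, Measurable[m] (age N S G A k s)) ∧ (s ≤ T → Measurable[m] (A s)) := by
  intro s
  induction s using Nat.strong_induction_on with
  | _ s ih =>
    intro h1 hst hsT
    have hA : ∀ s' ∈ Finset.Ico 1 s, Measurable[m] (A s') := fun s' hs' => by
      rw [Finset.mem_Ico] at hs'
      exact (ih s' hs'.2 hs'.1 (by omega) (by omega)).2 (by omega)
    have hS' : ∀ s' ∈ Finset.Ico 1 s, Measurable[m] (S s') := fun s' hs' =>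
      hS s' (Finset.Ico_subset_Ico_right hst hs')
    have hZ : ∀ k, Measurable[m] (age N S G A k s) := fun k =>
      measurable_headOfLineAge (hG k) s fun s' h h' =>
        N.measurable_reward k (hS' s' (Finset.mem_Ico.2 ⟨h, h'⟩)) (hA s' (Finset.mem_Ico.2 ⟨h, h'⟩))
    refine ⟨hZ, fun hs => (hist s (Finset.mem_Icc.2 ⟨h1, hs⟩)).mono (ageHistory_le hS' hA ?_) le_rfl⟩
    intro k s' hs'
    rw [Finset.mem_Icc] at hs'
    rcases hs'.2.lt_or_eq with h | rfl
    · exact (ih s' h hs'.1 (by omega) (by omega)).1 k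
    · exact hZ k

/-- The index of the next-to-depart request of node `k` in slot `t`. -/
noncomputable def nextRequest (N : Network K 𝒮 𝒜) (S : ℕ → Ω → 𝒮) (G : Fin K → ℕ → Ω → ℕ) (A : ℕ → Ω → 𝒜)
    (k : Fin K) (t : ℕ) (ω : Ω) : ℕ :=
  nextToDepart (fun i => G k i ω) (fun s => N.R k (S s ω) (A s ω)) t

/-- The states, the arrivals at the other nodes, and the first `j` interarrival times of
node `k`. -/
@[reducible]
def arrivalFiltration (S : ℕ → Ω → 𝒮) (G : Fin K → ℕ → Ω → ℕ) (k : Fin K) (j : ℕ) :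
    MeasurableSpace Ω :=
  (⨆ t, MeasurableSpace.comap (S t) inferInstance) ⊔
    ⨆ i ∈ {i : Fin K × ℕ | i.1 ≠ k ∨ i.2 < j}, MeasurableSpace.comap (G i.1 i.2) inferInstance

lemma arrivalFiltration_mono (S : ℕ → Ω → 𝒮) (G : Fin K → ℕ → Ω → ℕ) (k : Fin K) :
    Monotone (arrivalFiltration S G k) := fun _ _ h =>
  sup_le_sup_left (biSup_mono fun _ hi => hi.imp_right fun h' => h'.trans_le h) _

lemma measurable_state_arrivalFiltration (S : ℕ → Ω → 𝒮) (G : Fin K → ℕ → Ω → ℕ) (k : Fin K)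
    (j t : ℕ) : Measurable[arrivalFiltration S G k j] (S t) :=
  Measurable.of_comap_le
    ((le_iSup (fun t => MeasurableSpace.comap (S t) inferInstance) t).trans le_sup_left)

lemma measurable_arrival_arrivalFiltration (S : ℕ → Ω → 𝒮) (G : Fin K → ℕ → Ω → ℕ) (k : Fin K)
    {j : ℕ} {i : Fin K × ℕ} (hi : i.1 ≠ k ∨ i.2 < j) :
    Measurable[arrivalFiltration S G k j] (G i.1 i.2) :=
  Measurable.of_comap_le ((le_iSup₂ (f := fun (i : Fin K × ℕ)
    (_ : i ∈ {i : Fin K × ℕ | i.1 ≠ k ∨ i.2 < j}) =>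
      MeasurableSpace.comap (G i.1 i.2) inferInstance) i hi).trans le_sup_right)

/-- In slot `t` the actions and ages up to time `t` depend on the interarrival times of node `k`
only through those before the next-to-depart request. -/
lemma exists_measurable_stoppedSpace
    (hist : ∀ t ∈ Finset.Icc 1 T, Measurable[ageHistory N S G A t] (A t)) (k : Fin K)
    (t : ℕ) (h1 : 1 ≤ t) : t ≤ T →
    ∃ hℓ : ∀ j, MeasurableSet[arrivalFiltration S G k j] {ω | nextRequest N S G A k t ω = j},
      (∀ s ∈ Finset.Icc 1 t, Measurable[stoppedSpace _ _ hℓ] (A s)) ∧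
      ∀ k', ∀ s ∈ Finset.Icc 1 t, Measurable[stoppedSpace _ _ hℓ] (age N S G A k' s) := by
  have hSm : ∀ t (hℓ : ∀ j, MeasurableSet[arrivalFiltration S G k j]
      {ω | nextRequest N S G A k t ω = j}) s, Measurable[stoppedSpace _ _ hℓ] (S s) := fun t hℓ s =>
    measurable_stoppedSpace_of_forall (h := fun _ => S s) fun j =>
      measurable_state_arrivalFiltration S G k j s
  have hZm : ∀ t (hℓ : ∀ j, MeasurableSet[arrivalFiltration S G k j]
      {ω | nextRequest N S G A k t ω = j}) (_ : ∀ s ∈ Finset.Ico 1 t,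
        Measurable[stoppedSpace _ _ hℓ] (A s)) (k' : Fin K),
      Measurable[stoppedSpace _ _ hℓ] (age N S G A k' t) := by
    intro t hℓ hA k'
    -- At node `k` the age is read off from the interarrival times before the index. Another node's
    -- arrivals belong to every member of the filtration.
    by_cases hk : k' = k
    · subst hk
      exact measurable_stoppedSpace_of_forall
        (h := fun j ω => t - arrivalTime (fun i => G k' i ω) j) fun j =>
          (measurable_of_countable fun n : ℕ => t - n).comp
            (@measurable_arrivalTime Ω (arrivalFiltration S G k' j) _ j fun i hi =>
              measurable_arrival_arrivalFiltration S G k' (i := (k', i)) (Or.inr hi))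
    · exact @measurable_headOfLineAge Ω (stoppedSpace _ _ hℓ) (G k')
        (fun s ω => N.R k' (S s ω) (A s ω))
        (fun i => measurable_stoppedSpace_of_forall (h := fun _ => G k' i) fun j =>
          measurable_arrival_arrivalFiltration S G k (i := (k', i)) (Or.inl hk)) t
        fun s hs hs' => @Network.measurable_reward _ _ _ _ _ _ _ _ (stoppedSpace _ _ hℓ) N k' _ _
          (hSm t hℓ s) (hA s (Finset.mem_Ico.2 ⟨hs, hs'⟩))
  -- The ages in slot `t` use only earlier actions, and the action in slot `t` is then a function of
  -- the history. This order avoids circularity.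
  have close : ∀ t, 1 ≤ t → t ≤ T → ∀ (hℓ : ∀ j, MeasurableSet[arrivalFiltration S G k j]
      {ω | nextRequest N S G A k t ω = j}),
      (∀ s ∈ Finset.Ico 1 t, Measurable[stoppedSpace _ _ hℓ] (A s)) →
      (∀ k', ∀ s ∈ Finset.Ico 1 t, Measurable[stoppedSpace _ _ hℓ] (age N S G A k' s)) →
      (∀ s ∈ Finset.Icc 1 t, Measurable[stoppedSpace _ _ hℓ] (A s)) ∧
      ∀ k', ∀ s ∈ Finset.Icc 1 t, Measurable[stoppedSpace _ _ hℓ] (age N S G A k' s) := by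
    intro t h1 hT hℓ hA hZ
    have hZ' : ∀ k', ∀ s ∈ Finset.Icc 1 t, Measurable[stoppedSpace _ _ hℓ] (age N S G A k' s) := by
      intro k' s hs
      rw [Finset.mem_Icc] at hs
      rcases hs.2.lt_or_eq with h | rfl
      · exact hZ k' s (Finset.mem_Ico.2 ⟨hs.1, h⟩)
      · exact hZm _ hℓ hA k'
    refine ⟨fun s hs => ?_, hZ'⟩
    rw [Finset.mem_Icc] at hs
    rcases hs.2.lt_or_eq with h | rfl
    · exact hA s (Finset.mem_Ico.2 ⟨hs.1, h⟩)
    · exact (hist s (Finset.mem_Icc.2 ⟨h1, hT⟩)).mono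
        (ageHistory_le (fun s' _ => hSm _ hℓ s') hA hZ') le_rfl
  induction t, h1 using Nat.le_induction with
  | base =>
    intro hT
    have hℓ : ∀ j, MeasurableSet[arrivalFiltration S G k j] {ω | nextRequest N S G A k 1 ω = j} :=
      fun j => by
        simp only [nextRequest, nextToDepart, nonpos_iff_eq_zero, one_ne_zero, false_and, if_false]
        exact MeasurableSet.const _
    exact ⟨hℓ, close 1 le_rfl hT hℓ (by simp) (by simp)⟩
  | succ t h1 ih =>
    intro hT
    obtain ⟨hℓ, hA, hZ⟩ := ih (by omega)
    classical
    -- `D` is the event of a departure in slot `t`. It lies in the stopped σ-algebra, since it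
    -- involves the generation time of the next-to-depart request but not the interarrival time
    -- following it.
    let D : Set Ω := {ω | N.R k (S t ω) (A t ω) = 1 ∧
      arrivalTime (fun i => G k i ω) (nextRequest N S G A k t ω) ≤ t}
    have hD : MeasurableSet[stoppedSpace _ _ hℓ] D := by
      have hr : Measurable[stoppedSpace _ _ hℓ] fun ω => N.R k (S t ω) (A t ω) :=
        @Network.measurable_reward _ _ _ _ _ _ _ _ (stoppedSpace _ _ hℓ) N k _ _
          (hSm t hℓ t) (hA t (Finset.mem_Icc.2 ⟨h1, le_rfl⟩))
      refine MeasurableSet.inter (hr (measurableSet_singleton 1)) ?_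
      · exact measurable_stoppedSpace_of_forall (hℓ := hℓ)
          (h := fun j ω => arrivalTime (fun i => G k i ω) j) (fun j =>
            @measurable_arrivalTime Ω (arrivalFiltration S G k j) _ j fun i hi =>
            measurable_arrival_arrivalFiltration S G k (i := (k, i)) (Or.inr hi))
          (measurableSet_Iic (a := t))
    have hstep : nextRequest N S G A k (t + 1) = fun ω =>
        if ω ∈ D then nextRequest N S G A k t ω + 1 else nextRequest N S G A k t ω := by
      funext ω
      simp only [nextRequest, nextToDepart, h1, true_and]
      rfl
    have hℓ' : ∀ j, MeasurableSet[arrivalFiltration S G k j]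
        {ω | nextRequest N S G A k (t + 1) ω = j} := fun j => by
      rw [hstep]
      simpa using measurableSet_advance (arrivalFiltration_mono S G k) hD MeasurableSet.univ j
    have hle : stoppedSpace _ _ hℓ ≤ stoppedSpace _ _ hℓ' := fun B hB j => by
      simp only [hstep]
      exact measurableSet_advance (arrivalFiltration_mono S G k) hD hB j
    refine ⟨hℓ', close (t + 1) (by omega) hT hℓ' (fun s hs => ?_) (fun k' s hs => ?_)⟩
    · exact (hA s (by simpa [Nat.lt_succ_iff] using hs)).mono hle le_rfl
    · exact (hZ k' s (by simpa [Nat.lt_succ_iff] using hs)).mono hle le_rfl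

end Run

end AgeBandit

namespace AgeBandit

/-! ### A Wald-type identity. -/

section StoppedSpace

variable {Ω : Type*} [mΩ : MeasurableSpace Ω] {P : Measure Ω} [IsProbabilityMeasure P]

omit [IsProbabilityMeasure P] in
/-- A Wald-type identity: if `Y j` has mean `c` and is independent of `F j` for all `j`, then
`Y ℓ` behaves like an independent factor of mean `c` for a stopping time `ℓ`. -/
lemma integral_mul_stopped {F : ℕ → MeasurableSpace Ω} (hF : ∀ j, F j ≤ mΩ) {ℓ : Ω → ℕ}
    {hℓ : ∀ j, MeasurableSet[F j] {ω | ℓ ω = j}} {f : Ω → ℝ}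
    (hf : Measurable[stoppedSpace F ℓ hℓ] f) (hfi : Integrable f P) {Y : ℕ → Ω → ℝ} {c : ℝ}
    (hY : ∀ j, Integrable (Y j) P) (hYc : ∀ j, ∫ ω, Y j ω ∂P = c)
    (hind : ∀ j, Indep (F j) (MeasurableSpace.comap (Y j) inferInstance) P) {n : ℕ}
    (hn : ∀ ω, ℓ ω ≤ n) :
    Integrable (fun ω => f ω * Y (ℓ ω) ω) P ∧ ∫ ω, f ω * Y (ℓ ω) ω ∂P = (∫ ω, f ω ∂P) * c := by
  -- Decompose by the value of `ℓ`: each piece `φ j` is `F j`-measurable, hence independent of `Y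
  -- j`. As `ℓ` is bounded, the sum is finite.
  let φ : ℕ → Ω → ℝ := fun j ω => if ℓ ω = j then f ω else 0
  have hφm : ∀ j, Measurable[F j] (φ j) := measurable_ite_of_stoppedSpace hf
  have hφi : ∀ j, Integrable (φ j) P := fun j =>
    hfi.mono ((hφm j).mono (hF j) le_rfl).aestronglyMeasurable (ae_of_all _ fun ω => by
      by_cases h : ℓ ω = j <;> simp [φ, h])
  have hφY : ∀ j, IndepFun (φ j) (Y j) P := fun j =>
    indepFun_of_indep (hind j) (hφm j) (comap_measurable _)
  have hi : ∀ j, Integrable (fun ω => φ j ω * Y j ω) P := fun j =>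
    (hφY j).integrable_mul (hφi j) (hY j)
  have e1 : (fun ω => f ω * Y (ℓ ω) ω) = fun ω => ∑ j ∈ Finset.range (n + 1), φ j ω * Y j ω := by
    funext ω
    have := hn ω
    rw [Finset.sum_eq_single (ℓ ω)]
    · simp [φ]
    · intro j _ hj; simp [φ, hj.symm]
    · intro h; simp only [Finset.mem_range] at h; omega
  have e2 : f = fun ω => ∑ j ∈ Finset.range (n + 1), φ j ω := by
    funext ω
    have := hn ω
    rw [Finset.sum_eq_single (ℓ ω)]
    · simp [φ]
    · intro j _ hj; simp [φ, hj.symm]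
    · intro h; simp only [Finset.mem_range] at h; omega
  refine ⟨e1 ▸ integrable_finsetSum _ fun j _ => hi j, ?_⟩
  have e3 : ∫ ω, f ω ∂P = ∑ j ∈ Finset.range (n + 1), ∫ ω, φ j ω ∂P := by
    conv_lhs => rw [e2]
    exact integral_finsetSum _ fun j _ => hφi j
  rw [e1, integral_finsetSum _ fun j _ => hi j, e3, Finset.sum_mul]
  refine Finset.sum_congr rfl fun j _ => ?_
  rw [(hφY j).integral_fun_mul_eq_mul_integral (hφi j).aestronglyMeasurable
    (hY j).aestronglyMeasurable, hYc j]

end StoppedSpace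

/-! ### Pathwise drift of the squared age. -/

section Queue

variable {g : ℕ → ℕ} {r : ℕ → ℝ}

lemma nextToDepart_le (g : ℕ → ℕ) (r : ℕ → ℝ) (t : ℕ) : nextToDepart g r t ≤ t + 1 := by
  induction t with
  | zero => simp [nextToDepart]
  | succ t ih => rw [nextToDepart]; split_ifs <;> omega

lemma headOfLineAge_le (g : ℕ → ℕ) (r : ℕ → ℝ) (t : ℕ) : headOfLineAge g r t ≤ t :=
  Nat.sub_le _ _

lemma headOfLineAge_one (hg : ∀ i, 1 ≤ g i) : headOfLineAge g r 1 = 0 := by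
  have := hg 0
  simp [headOfLineAge, nextToDepart, arrivalTime]
  omega

/-- The one-slot drift of the squared head-of-line age. -/
lemma headOfLineAge_succ_sq_le (hg : ∀ i, 1 ≤ g i) {t : ℕ} (ht : 1 ≤ t) (hr : r t = 0 ∨ r t = 1) :
    (headOfLineAge g r (t + 1) : ℝ) ^ 2 ≤ (headOfLineAge g r t : ℝ) ^ 2
      + 2 * headOfLineAge g r t - 2 * (headOfLineAge g r t * r t * g (nextToDepart g r t))
      + (g (nextToDepart g r t) : ℝ) ^ 2 := by
  have hG : (1 : ℝ) ≤ g (nextToDepart g r t) := by exact_mod_cast hg _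
  have hstep : nextToDepart g r (t + 1) = if 1 ≤ t ∧ r t = 1 ∧ arrivalTime g (nextToDepart g r t) ≤ t
    then nextToDepart g r t + 1 else nextToDepart g r t := rfl
  have hnon : (0 : ℝ) ≤ headOfLineAge g r t := Nat.cast_nonneg _
  rcases hr with hr | hr
  -- Without a departure `(Z+1)² = Z² + 2Z + 1`, and the `1` is absorbed by `g² ≥ 1`. Keeping `g²`
  -- in both cases makes its expectation available without conditioning on service.
  · have hle : headOfLineAge g r (t + 1) ≤ headOfLineAge g r t + 1 := by
      simp only [headOfLineAge, hstep, hr, zero_ne_one, false_and, and_false, if_false]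
      omega
    have hle' : (headOfLineAge g r (t + 1) : ℝ) ≤ headOfLineAge g r t + 1 := by exact_mod_cast hle
    have := pow_le_pow_left₀ (Nat.cast_nonneg _) hle' 2
    rw [hr]
    nlinarith
  · by_cases ha : arrivalTime g (nextToDepart g r t) ≤ t
    · have he : headOfLineAge g r (t + 1) = headOfLineAge g r t + 1 - g (nextToDepart g r t) := by
        have h1 : nextToDepart g r (t + 1) = nextToDepart g r t + 1 := by
          rw [hstep, if_pos ⟨ht, hr, ha⟩]
        have h2 : arrivalTime g (nextToDepart g r t + 1) =
          arrivalTime g (nextToDepart g r t) + g (nextToDepart g r t) := Finset.sum_range_succ _ _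
        simp only [headOfLineAge, h1, h2]
        omega
      rw [hr]
      rcases le_total (g (nextToDepart g r t)) (headOfLineAge g r t + 1) with h | h
      · rw [he, Nat.cast_sub h]
        push_cast
        nlinarith
      · rw [he, Nat.sub_eq_zero_of_le h]
        have h' : (headOfLineAge g r t : ℝ) + 1 ≤ g (nextToDepart g r t) := by exact_mod_cast h
        push_cast
        nlinarith [sq_nonneg ((headOfLineAge g r t : ℝ) - g (nextToDepart g r t))]
    -- The request is still to be generated, at `t + 1` or later, so the age is zero now and in the
    -- next slot.
    · have h0 : headOfLineAge g r t = 0 := by simp only [headOfLineAge]; omega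
      have h1 : headOfLineAge g r (t + 1) = 0 := by
        simp only [headOfLineAge, hstep, ha, and_false, if_false]; omega
      rw [h0, h1]
      simp

end Queue

/-! ### Lyapunov bound for the ages. -/

section Run

variable {K : ℕ} {𝒮 𝒜 : Type u} [MeasurableSpace 𝒮] {N : Network K 𝒮 𝒜}

lemma Network.R_eq_zero_or_one (N : Network K 𝒮 𝒜) (k : Fin K) (s : 𝒮) (a : 𝒜) :
    N.R k s a = 0 ∨ N.R k s a = 1 := by
  rcases N.X_binary k s with h | h <;> rcases N.I_binary k a with h' | h' <;>
    simp [Network.R, h, h']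

lemma Network.X_mem (N : Network K 𝒮 𝒜) (k : Fin K) (s : 𝒮) : N.X k s ∈ Set.Icc (0 : ℝ) 1 := by
  rcases N.X_binary k s with h | h <;> simp [h]

lemma Network.I_mem (N : Network K 𝒮 𝒜) (k : Fin K) (a : 𝒜) : N.I k a ∈ Set.Icc (0 : ℝ) 1 := by
  rcases N.I_binary k a with h | h <;> simp [h]

variable {Ω : Type v} [mΩ : MeasurableSpace Ω] {P : Measure Ω} [IsProbabilityMeasure P]
  {S : ℕ → Ω → 𝒮} {G : Fin K → ℕ → Ω → ℕ} {A : ℕ → Ω → 𝒜} {p : Fin K → ℝ}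

/-- The states before slot `t` and all arrivals. -/
@[reducible]
def past (S : ℕ → Ω → 𝒮) (G : Fin K → ℕ → Ω → ℕ) (t : ℕ) : MeasurableSpace Ω :=
  (⨆ i : Fin K × ℕ, MeasurableSpace.comap (G i.1 i.2) inferInstance) ⊔
    ⨆ s ∈ Set.Iio t, MeasurableSpace.comap (S s) inferInstance

omit mΩ in
lemma measurable_state_past {s t : ℕ} (h : s < t) : Measurable[past S G t] (S s) :=
  Measurable.of_comap_le ((le_iSup₂ (f := fun s (_ : s ∈ Set.Iio t) =>
    MeasurableSpace.comap (S s) inferInstance) s h).trans le_sup_right)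

omit mΩ in
lemma measurable_arrival_past {t : ℕ} (k : Fin K) (i : ℕ) : Measurable[past S G t] (G k i) :=
  Measurable.of_comap_le ((le_iSup (fun i : Fin K × ℕ =>
    MeasurableSpace.comap (G i.1 i.2) inferInstance) (k, i)).trans le_sup_left)

omit [IsProbabilityMeasure P] in
lemma past_le (hS : N.IsStateSequence P S) (hG : IsArrivalSequence P S p G) (t : ℕ) :
    past S G t ≤ mΩ :=
  sup_le (iSup_le fun i => (hG.measurable i.1 i.2).comap_le)
    (iSup₂_le fun s _ => (hS.measurable s).comap_le)

omit [IsProbabilityMeasure P] in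
lemma arrivalFiltration_le (hS : N.IsStateSequence P S) (hG : IsArrivalSequence P S p G)
    (k : Fin K) (j : ℕ) : arrivalFiltration S G k j ≤ mΩ :=
  sup_le (iSup_le fun s => (hS.measurable s).comap_le)
    (iSup₂_le fun i _ => (hG.measurable i.1 i.2).comap_le)

omit [IsProbabilityMeasure P] in
lemma indep_states_arrivals (hG : IsArrivalSequence P S p G) :
    Indep (⨆ t, MeasurableSpace.comap (S t) inferInstance)
      (⨆ i : Fin K × ℕ, MeasurableSpace.comap (G i.1 i.2) inferInstance) P := by
  refine indep_of_indep_of_le ((IndepFun_iff_Indep _ _ _).1 hG.indep_states)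
    (iSup_le fun t => ?_) (iSup_le fun i => ?_)
  · exact ((measurable_pi_apply t).comp (comap_measurable (fun ω t => S t ω))).comap_le
  · exact ((measurable_pi_apply i).comp
      (comap_measurable (fun ω (i : Fin K × ℕ) => G i.1 i.2 ω))).comap_le

/-- The arrivals are independent of all states jointly, and the earlier states of the present one;
`indep_sup_left_of_indep_sup` combines the two. -/
lemma indep_past (hS : N.IsStateSequence P S) (hG : IsArrivalSequence P S p G) (t : ℕ) :
    Indep (past S G t) (MeasurableSpace.comap (S t) inferInstance) P := by
  refine indep_sup_left_of_indep_sup (iSup₂_le fun s _ => (hS.measurable s).comap_le)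
    (hS.measurable t).comap_le (iSup_le fun i => (hG.measurable i.1 i.2).comap_le) ?_ ?_
  · refine indep_of_indep_of_le_right (indep_states_arrivals hG).symm (sup_le ?_ ?_)
    · exact iSup₂_le fun s _ => le_iSup (fun t => MeasurableSpace.comap (S t) inferInstance) s
    · exact le_iSup (fun t => MeasurableSpace.comap (S t) inferInstance) t
  · have := indep_iSup_of_disjoint (fun s => (hS.measurable s).comap_le) hS.indep
      (S := Set.Iio t) (T := {t}) (by simp)
    simpa using this

/-- The same combination with the roles exchanged. All states, future ones included, may be adjoined
because they are jointly independent of the arrivals. -/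
lemma indep_arrivalFiltration (hS : N.IsStateSequence P S) (hG : IsArrivalSequence P S p G)
    (k : Fin K) (j : ℕ) :
    Indep (arrivalFiltration S G k j) (MeasurableSpace.comap (G k j) inferInstance) P := by
  refine indep_sup_left_of_indep_sup (iSup₂_le fun i _ => (hG.measurable i.1 i.2).comap_le)
    (hG.measurable k j).comap_le (iSup_le fun s => (hS.measurable s).comap_le) ?_ ?_
  · refine indep_of_indep_of_le_right (indep_states_arrivals hG) (sup_le ?_ ?_)
    · exact iSup₂_le fun i _ =>
        le_iSup (fun i : Fin K × ℕ => MeasurableSpace.comap (G i.1 i.2) inferInstance) i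
    · exact le_iSup (fun i : Fin K × ℕ => MeasurableSpace.comap (G i.1 i.2) inferInstance) (k, j)
  · have := indep_iSup_of_disjoint (fun i : Fin K × ℕ => (hG.measurable i.1 i.2).comap_le) hG.indep
      (S := {i : Fin K × ℕ | i.1 ≠ k ∨ i.2 < j}) (T := {(k, j)}) (by simp)
    simpa using this

omit [IsProbabilityMeasure P] in
lemma integral_comp_state (hS : N.IsStateSequence P S) {h : 𝒮 → ℝ} (hh : Measurable h) (t : ℕ) :
    ∫ ω, h (S t ω) ∂P = ∫ s, h s ∂N.law := by
  rw [← hS.law_eq t, integral_map (hS.measurable t).aemeasurable hh.aestronglyMeasurable]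

/-- Factors that are determined by the past are independent of the present state. -/
lemma integral_mul_comp_state (hS : N.IsStateSequence P S) (hG : IsArrivalSequence P S p G)
    {t : ℕ} {f : Ω → ℝ} (hf : Measurable[past S G t] f) {h : 𝒮 → ℝ} (hh : Measurable h) :
    ∫ ω, f ω * h (S t ω) ∂P = (∫ ω, f ω ∂P) * ∫ s, h s ∂N.law := by
  rw [← integral_comp_state hS hh t]
  exact (indepFun_of_indep (indep_past hS hG t) hf
    (hh.comp (comap_measurable (S t)))).integral_fun_mul_eq_mul_integral
    (hf.mono (past_le hS hG t) le_rfl).aestronglyMeasurable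
    (hh.comp (hS.measurable t)).aestronglyMeasurable

variable [MeasurableSpace 𝒜] [MeasurableSingletonClass 𝒜] [Fintype 𝒜] {T : ℕ}

omit mΩ in
lemma measurable_age_past (hist : ∀ t ∈ Finset.Icc 1 T, Measurable[ageHistory N S G A t] (A t))
    (k : Fin K) {s t : ℕ} (h1 : 1 ≤ s) (hst : s ≤ t) (hsT : s ≤ T + 1) :
    Measurable[past S G t] (age N S G A k s) :=
  (measurable_age_and_action hist (fun _ h => measurable_state_past (Finset.mem_Ico.1 h).2)
    measurable_arrival_past s h1 hst hsT).1 k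

omit mΩ in
lemma measurable_action_past (hist : ∀ t ∈ Finset.Icc 1 T, Measurable[ageHistory N S G A t] (A t))
    {s t : ℕ} (h1 : 1 ≤ s) (hst : s ≤ t) (hsT : s ≤ T) : Measurable[past S G t] (A s) :=
  (measurable_age_and_action hist (fun _ h => measurable_state_past (Finset.mem_Ico.1 h).2)
    measurable_arrival_past s h1 hst (by omega)).2 hsT

omit [IsProbabilityMeasure P] in
lemma measurable_action (hS : N.IsStateSequence P S) (hG : IsArrivalSequence P S p G)
    (hist : ∀ t ∈ Finset.Icc 1 T, Measurable[ageHistory N S G A t] (A t))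
    {t : ℕ} (h1 : 1 ≤ t) (hT : t ≤ T) : Measurable (A t) :=
  (measurable_action_past hist h1 le_rfl hT).mono (past_le hS hG t) le_rfl

omit [IsProbabilityMeasure P] in
lemma measurable_age (hS : N.IsStateSequence P S) (hG : IsArrivalSequence P S p G)
    (hist : ∀ t ∈ Finset.Icc 1 T, Measurable[ageHistory N S G A t] (A t)) (k : Fin K)
    {t : ℕ} (h1 : 1 ≤ t) (hT : t ≤ T + 1) : Measurable fun ω => (age N S G A k t ω : ℝ) :=
  measurable_from_nat.comp ((measurable_age_past hist k h1 le_rfl hT).mono (past_le hS hG t) le_rfl)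

lemma integrable_of_abs_le {f : Ω → ℝ} (hf : Measurable f) (c : ℝ) (h : ∀ ω, |f ω| ≤ c) :
    Integrable f P :=
  Integrable.of_bound hf.aestronglyMeasurable c (ae_of_all _ h)

omit mΩ [MeasurableSpace 𝒜] [MeasurableSingletonClass 𝒜] [Fintype 𝒜] in
lemma age_le (k : Fin K) (t : ℕ) (ω : Ω) : (age N S G A k t ω : ℝ) ≤ t := by
  exact_mod_cast headOfLineAge_le _ _ t

lemma integrable_age (hS : N.IsStateSequence P S) (hG : IsArrivalSequence P S p G)
    (hist : ∀ t ∈ Finset.Icc 1 T, Measurable[ageHistory N S G A t] (A t)) (k : Fin K)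
    {t : ℕ} (h1 : 1 ≤ t) (hT : t ≤ T + 1) : Integrable (fun ω => (age N S G A k t ω : ℝ)) P :=
  integrable_of_abs_le (measurable_age hS hG hist k h1 hT) t fun ω => by
    rw [abs_of_nonneg (Nat.cast_nonneg _)]; exact age_le k t ω

lemma integrable_age_mul_I (hS : N.IsStateSequence P S) (hG : IsArrivalSequence P S p G)
    (hist : ∀ t ∈ Finset.Icc 1 T, Measurable[ageHistory N S G A t] (A t)) (k : Fin K)
    {t : ℕ} (h1 : 1 ≤ t) (hT : t ≤ T) :
    Integrable (fun ω => (age N S G A k t ω : ℝ) * N.I k (A t ω)) P :=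
  integrable_of_abs_le ((measurable_age hS hG hist k h1 (by omega)).mul
    ((measurable_of_finite (N.I k)).comp (measurable_action hS hG hist h1 hT))) t fun ω => by
      have h := N.I_mem k (A t ω)
      rw [abs_of_nonneg (mul_nonneg (Nat.cast_nonneg _) h.1)]
      exact (mul_le_of_le_one_right (Nat.cast_nonneg _) h.2).trans (age_le k t ω)

lemma integral_reward (hS : N.IsStateSequence P S) (hG : IsArrivalSequence P S p G)
    (hist : ∀ t ∈ Finset.Icc 1 T, Measurable[ageHistory N S G A t] (A t)) (k : Fin K)
    {t : ℕ} (h1 : 1 ≤ t) (hT : t ≤ T) :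
    ∫ ω, N.R k (S t ω) (A t ω) ∂P = N.rate k * ∫ ω, N.I k (A t ω) ∂P := by
  rw [mul_comm, Network.rate, ← integral_mul_comp_state hS hG (f := fun ω => N.I k (A t ω))
    ((measurable_of_finite (N.I k)).comp (measurable_action_past hist h1 le_rfl hT))
    (N.measurable_X k)]
  exact integral_congr_ae (ae_of_all _ fun ω => mul_comm _ _)

/-- The Lyapunov bound: the age-weighted service falls short of the age-weighted demand by a
bounded amount per slot. -/
lemma sum_integral_age_mul_le (hS : N.IsStateSequence P S) (hG : IsArrivalSequence P S p G)
    (hist : ∀ t ∈ Finset.Icc 1 T, Measurable[ageHistory N S G A t] (A t)) (k : Fin K)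
    (hp : 0 < p k) (hp' : p k ≤ 1) (hx : 0 < N.rate k) :
    ∑ t ∈ Finset.Icc 1 T, ∫ ω, (age N S G A k t ω : ℝ) * N.I k (A t ω) ∂P ≤
      p k / N.rate k * ∑ t ∈ Finset.Icc 1 T, ∫ ω, (age N S G A k t ω : ℝ) ∂P
        + T / (p k * N.rate k) := by
  have hgeo : ∀ j, Integrable (fun ω => (G k j ω : ℝ)) P ∧ ∫ ω, (G k j ω : ℝ) ∂P = 1 / p k :=
    fun j => integral_of_geometric (hG.measurable k j) hp hp' (hG.geometric k j)
  have hgeo2 : ∀ j, Integrable (fun ω => (G k j ω : ℝ) ^ 2) P ∧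
      ∫ ω, (G k j ω : ℝ) ^ 2 ∂P = 2 / p k ^ 2 - 1 / p k :=
    fun j => integral_sq_of_geometric (hG.measurable k j) hp hp' (hG.geometric k j)
  have hpos : ∀ᵐ ω ∂P, ∀ j, 1 ≤ G k j ω :=
    ae_all_iff.2 fun j => ae_one_le_of_geometric (hG.measurable k j) hp hp' (hG.geometric k j)
  have hle : ∀ ω t, nextRequest N S G A k t ω ≤ t + 1 := fun ω t => nextToDepart_le _ _ t
  have hsqi : ∀ t, 1 ≤ t → t ≤ T + 1 → Integrable (fun ω => (age N S G A k t ω : ℝ) ^ 2) P :=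
    fun t h1 hT => integrable_of_abs_le ((measurable_age hS hG hist k h1 hT).pow_const 2)
      ((t : ℝ) ^ 2) fun ω => by
        rw [abs_of_nonneg (by positivity)]
        exact pow_le_pow_left₀ (Nat.cast_nonneg _) (age_le k t ω) 2
  have hdrift : ∀ t, 1 ≤ t → t ≤ T →
      ∫ ω, (age N S G A k (t + 1) ω : ℝ) ^ 2 ∂P ≤ ∫ ω, (age N S G A k t ω : ℝ) ^ 2 ∂P +
        (2 * ∫ ω, (age N S G A k t ω : ℝ) ∂P - 2 * (N.rate k / p k *
          ∫ ω, (age N S G A k t ω : ℝ) * N.I k (A t ω) ∂P) + 2 / p k ^ 2) := by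
    intro t h1 hT
    obtain ⟨hℓ, hA, hZ⟩ := exists_measurable_stoppedSpace hist k t h1 hT
    have htt : t ∈ Finset.Icc 1 t := Finset.mem_Icc.2 ⟨h1, le_rfl⟩
    have hF := arrivalFiltration_le hS hG k
    have hind1 : ∀ j, Indep (arrivalFiltration S G k j)
        (MeasurableSpace.comap (fun ω => (G k j ω : ℝ)) inferInstance) P := fun j =>
      indep_of_indep_of_le_right (indep_arrivalFiltration hS hG k j)
        ((measurable_from_nat (f := fun n : ℕ => (n : ℝ))).comp (comap_measurable _)).comap_le
    have hind2 : ∀ j, Indep (arrivalFiltration S G k j)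
        (MeasurableSpace.comap (fun ω => (G k j ω : ℝ) ^ 2) inferInstance) P := fun j =>
      indep_of_indep_of_le_right (indep_arrivalFiltration hS hG k j)
        ((measurable_from_nat (f := fun n : ℕ => (n : ℝ) ^ 2)).comp (comap_measurable _)).comap_le
    have hrm : Measurable[stoppedSpace _ _ hℓ] fun ω => N.R k (S t ω) (A t ω) :=
      @Network.measurable_reward _ _ _ _ _ _ _ _ (stoppedSpace _ _ hℓ) N k _ _
        (measurable_stoppedSpace_of_forall (h := fun _ => S t) fun j =>
          measurable_state_arrivalFiltration S G k j t) (hA t htt)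
    have hZr : Measurable[stoppedSpace _ _ hℓ]
        fun ω => (age N S G A k t ω : ℝ) * N.R k (S t ω) (A t ω) :=
      ((measurable_from_nat (f := fun n : ℕ => (n : ℝ))).comp (hZ k t htt)).mul hrm
    have hZri : Integrable (fun ω => (age N S G A k t ω : ℝ) * N.R k (S t ω) (A t ω)) P :=
      integrable_of_abs_le ((measurable_age hS hG hist k h1 (by omega)).mul
        (N.measurable_reward k (hS.measurable t) (measurable_action hS hG hist h1 hT))) t fun ω => by
          rw [abs_of_nonneg (mul_nonneg (Nat.cast_nonneg _) (by
            rcases N.R_eq_zero_or_one k (S t ω) (A t ω) with h | h <;> simp [h]))]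
          rcases N.R_eq_zero_or_one k (S t ω) (A t ω) with h | h
          · simp [h]
          · rw [h, mul_one]; exact age_le k t ω
    -- Wald's identity is used twice: with factor `Z * R` for the cross term, and below with factor
    -- `1` for `g²`.
    obtain ⟨hi1, he1⟩ := integral_mul_stopped hF hZr hZri (fun j => (hgeo j).1) (fun j => (hgeo j).2)
      hind1 (fun ω => hle ω t)
    obtain ⟨hi2, he2⟩ := integral_mul_stopped hF (hℓ := hℓ) (f := fun _ => 1)
      (@measurable_const _ _ _ (stoppedSpace _ _ hℓ) _) (integrable_const (1 : ℝ))
      (fun j => (hgeo2 j).1) (fun j => (hgeo2 j).2) hind2 (fun ω => hle ω t)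
    simp only [one_mul, integral_const, smul_eq_mul, mul_one, probReal_univ] at hi2 he2
    have hEr : ∫ ω, (age N S G A k t ω : ℝ) * N.R k (S t ω) (A t ω) ∂P =
        (∫ ω, (age N S G A k t ω : ℝ) * N.I k (A t ω) ∂P) * N.rate k := by
      rw [Network.rate, ← integral_mul_comp_state hS hG
        (f := fun ω => (age N S G A k t ω : ℝ) * N.I k (A t ω))
        (((measurable_from_nat (f := fun n : ℕ => (n : ℝ))).comp
          (measurable_age_past hist k h1 le_rfl (by omega))).mul
          ((measurable_of_finite (N.I k)).comp (measurable_action_past hist h1 le_rfl hT)))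
        (N.measurable_X k)]
      refine integral_congr_ae (ae_of_all _ fun ω => ?_)
      simp only [Network.R]
      ring
    have hZi := integrable_age hS hG hist k h1 (by omega : t ≤ T + 1)
    have hZs := hsqi t h1 (by omega)
    have i1 : Integrable (fun ω => (age N S G A k t ω : ℝ) ^ 2 + 2 * age N S G A k t ω) P :=
      hZs.add (hZi.const_mul 2)
    have i2 : Integrable (fun ω => (age N S G A k t ω : ℝ) ^ 2 + 2 * age N S G A k t ω
        - 2 * (age N S G A k t ω * N.R k (S t ω) (A t ω) * G k (nextRequest N S G A k t ω) ω)) P :=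
      i1.sub (hi1.const_mul 2)
    calc ∫ ω, (age N S G A k (t + 1) ω : ℝ) ^ 2 ∂P
        ≤ ∫ ω, ((age N S G A k t ω : ℝ) ^ 2 + 2 * age N S G A k t ω
            - 2 * (age N S G A k t ω * N.R k (S t ω) (A t ω) * G k (nextRequest N S G A k t ω) ω)
            + (G k (nextRequest N S G A k t ω) ω : ℝ) ^ 2) ∂P := by
          refine integral_mono_ae (hsqi (t + 1) (by omega) (by omega))
            (i2.add hi2) ?_
          filter_upwards [hpos] with ω hω
          exact headOfLineAge_succ_sq_le (r := fun s => N.R k (S s ω) (A s ω)) hω h1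
            (N.R_eq_zero_or_one _ _ _)
      _ = ∫ ω, (age N S G A k t ω : ℝ) ^ 2 ∂P + 2 * ∫ ω, (age N S G A k t ω : ℝ) ∂P
            - 2 * ((∫ ω, (age N S G A k t ω : ℝ) * N.I k (A t ω) ∂P) * N.rate k * (1 / p k))
            + (2 / p k ^ 2 - 1 / p k) := by
          rw [integral_add i2 hi2, integral_sub i1 (hi1.const_mul 2),
            integral_add hZs (hZi.const_mul 2), integral_const_mul, integral_const_mul, he1, he2, hEr]
      -- The term `-1/p` of the second moment is dropped.
      _ ≤ _ := by
          have : 0 ≤ 1 / p k := by positivity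
          linarith [show (∫ ω, (age N S G A k t ω : ℝ) * N.I k (A t ω) ∂P) * N.rate k * (1 / p k)
            = N.rate k / p k * ∫ ω, (age N S G A k t ω : ℝ) * N.I k (A t ω) ∂P by ring]
  have hsum : ∀ n, n ≤ T → ∫ ω, (age N S G A k (n + 1) ω : ℝ) ^ 2 ∂P ≤ ∑ t ∈ Finset.Icc 1 n,
      (2 * ∫ ω, (age N S G A k t ω : ℝ) ∂P - 2 * (N.rate k / p k *
          ∫ ω, (age N S G A k t ω : ℝ) * N.I k (A t ω) ∂P) + 2 / p k ^ 2) := by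
    intro n
    induction n with
    | zero =>
      intro _
      have : (fun ω => (age N S G A k (0 + 1) ω : ℝ) ^ 2) =ᵐ[P] fun _ => 0 := by
        filter_upwards [hpos] with ω hω
        simp [age, headOfLineAge_one hω]
      rw [integral_congr_ae this]
      simp
    | succ n ih =>
      intro hn
      rw [Finset.sum_Icc_succ_top (by omega)]
      exact (hdrift (n + 1) (by omega) hn).trans (add_le_add_left (ih (by omega)) _)
  -- The telescoped drifts start from age zero in slot `1` and end at a nonnegative `E Z²`, so their
  -- sum is nonnegative. Solving for the service term gives the claim.
  have h0 := (integral_nonneg fun ω => sq_nonneg _).trans (hsum T le_rfl)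
  rw [Finset.sum_add_distrib, Finset.sum_sub_distrib, ← Finset.mul_sum, ← Finset.mul_sum,
    ← Finset.mul_sum, Finset.sum_const, Nat.card_Icc, Nat.add_sub_cancel, nsmul_eq_mul] at h0
  set a := ∑ t ∈ Finset.Icc 1 T, ∫ ω, (age N S G A k t ω : ℝ) ∂P
  set b := ∑ t ∈ Finset.Icc 1 T, ∫ ω, (age N S G A k t ω : ℝ) * N.I k (A t ω) ∂P
  have h1 : N.rate k / p k * b ≤ a + T / p k ^ 2 := by
    have : (T : ℝ) * (2 / p k ^ 2) = 2 * (T / p k ^ 2) := by ring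
    linarith
  calc b = p k / N.rate k * (N.rate k / p k * b) := by field_simp
    _ ≤ p k / N.rate k * (a + T / p k ^ 2) := mul_le_mul_of_nonneg_left h1 (by positivity)
    _ = _ := by field_simp

end Run

end AgeBandit

namespace AgeBandit

/-! ### Concentration of the UCB estimates. -/

section Concentration

variable {K : ℕ} {𝒮 𝒜 : Type u} [MeasurableSpace 𝒮] {N : Network K 𝒮 𝒜}

lemma Network.integrable_X (N : Network K 𝒮 𝒜) (k : Fin K) : Integrable (N.X k) N.law := by
  have := N.isProbabilityMeasure_law
  refine integrable_of_abs_le (N.measurable_X k) 1 fun s => ?_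
  have h := N.X_mem k s
  rw [abs_of_nonneg h.1]
  exact h.2

lemma Network.rate_nonneg (N : Network K 𝒮 𝒜) (k : Fin K) : 0 ≤ N.rate k :=
  integral_nonneg fun s => (N.X_mem k s).1

lemma Network.rate_le_one (N : Network K 𝒮 𝒜) (k : Fin K) : N.rate k ≤ 1 := by
  have := N.isProbabilityMeasure_law
  have h := integral_mono (N.integrable_X k) (integrable_const 1) fun s => (N.X_mem k s).2
  rwa [integral_const, probReal_univ, one_smul] at h

/-- Hoeffding's lemma for the channel state of a node. -/
lemma Network.integral_exp_le_one (N : Network K 𝒮 𝒜) (k : Fin K) (θ : ℝ) :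
    ∫ s, Real.exp (θ * (N.X k s - N.rate k) - θ ^ 2 / 8) ∂N.law ≤ 1 := by
  have := N.isProbabilityMeasure_law
  have h := (hasSubgaussianMGF_of_mem_Icc (μ := N.law) (N.measurable_X k).aemeasurable
    (ae_of_all _ (N.X_mem k))).mgf_le θ
  have e : ∀ s, Real.exp (θ * (N.X k s - N.rate k) - θ ^ 2 / 8) =
      Real.exp (θ * (N.X k s - ∫ s, N.X k s ∂N.law)) * Real.exp (-(θ ^ 2 / 8)) := fun s => by
    rw [← Real.exp_add]; rfl
  simp_rw [e]
  rw [integral_mul_const]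
  calc _ ≤ _ := mul_le_mul_of_nonneg_right h (Real.exp_pos _).le
    _ = 1 := by
      rw [← Real.exp_add, Real.exp_eq_one_iff]
      simp
      ring

variable {Ω : Type v} [mΩ : MeasurableSpace Ω] {P : Measure Ω} [IsProbabilityMeasure P]
  {S : ℕ → Ω → 𝒮} {G : Fin K → ℕ → Ω → ℕ} {A : ℕ → Ω → 𝒜} {p : Fin K → ℝ}
  [MeasurableSpace 𝒜] [MeasurableSingletonClass 𝒜] [Fintype 𝒜] {T : ℕ}

/-- The centred cumulative reward of node `k` before slot `t`. -/
noncomputable def rewardNoise (N : Network K 𝒮 𝒜) (S : ℕ → Ω → 𝒮) (A : ℕ → Ω → 𝒜) (k : Fin K)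
    (t : ℕ) (ω : Ω) : ℝ :=
  ∑ s ∈ Finset.Ico 1 t, (N.X k (S s ω) - N.rate k) * N.I k (A s ω)

omit mΩ [MeasurableSpace 𝒜] [MeasurableSingletonClass 𝒜] [Fintype 𝒜] in
lemma sum_reward_eq (k : Fin K) (t : ℕ) (ω : Ω) :
    ∑ s ∈ Finset.Ico 1 t, N.R k (S s ω) (A s ω) =
      rewardNoise N S A k t ω + N.rate k * playCount N A k t ω := by
  rw [rewardNoise, playCount, Finset.mul_sum, ← Finset.sum_add_distrib]
  exact Finset.sum_congr rfl fun s _ => by simp only [Network.R]; ring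

omit mΩ in
lemma measurable_playCount_past
    (hist : ∀ t ∈ Finset.Icc 1 T, Measurable[ageHistory N S G A t] (A t)) (k : Fin K) {t : ℕ}
    (hT : t ≤ T + 1) : Measurable[past S G t] (playCount N A k t) := by
  let _ := past S G t
  refine Finset.measurable_sum _ fun s hs => ?_
  rw [Finset.mem_Ico] at hs
  exact (measurable_of_finite (N.I k)).comp (measurable_action_past hist hs.1 hs.2.le (by omega))

omit mΩ in
lemma measurable_rewardNoise_past
    (hist : ∀ t ∈ Finset.Icc 1 T, Measurable[ageHistory N S G A t] (A t)) (k : Fin K) {t : ℕ}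
    (hT : t ≤ T + 1) : Measurable[past S G t] (rewardNoise N S A k t) := by
  let _ := past S G t
  refine Finset.measurable_sum _ fun s hs => ?_
  rw [Finset.mem_Ico] at hs
  exact (((N.measurable_X k).comp (measurable_state_past hs.2)).sub_const _).mul
    ((measurable_of_finite (N.I k)).comp (measurable_action_past hist hs.1 hs.2.le (by omega)))

omit mΩ [MeasurableSpace 𝒜] [MeasurableSingletonClass 𝒜] [Fintype 𝒜] in
lemma playCount_nonneg (k : Fin K) (t : ℕ) (ω : Ω) : 0 ≤ playCount N A k t ω :=
  Finset.sum_nonneg fun s _ => (N.I_mem k (A s ω)).1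

omit mΩ [MeasurableSpace 𝒜] [MeasurableSingletonClass 𝒜] [Fintype 𝒜] in
lemma playCount_succ (k : Fin K) {t : ℕ} (ht : 1 ≤ t) (ω : Ω) :
    playCount N A k (t + 1) ω = playCount N A k t ω + N.I k (A t ω) :=
  Finset.sum_Ico_succ_top ht _

omit mΩ [MeasurableSpace 𝒜] [MeasurableSingletonClass 𝒜] [Fintype 𝒜] in
lemma exists_playCount_eq (k : Fin K) (t : ℕ) (ω : Ω) :
    ∃ n : ℕ, n ≤ t - 1 ∧ playCount N A k t ω = n := by
  classical
  refine ⟨((Finset.Ico 1 t).filter fun s => N.I k (A s ω) = 1).card, ?_, ?_⟩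
  · simpa using Finset.card_filter_le (Finset.Ico 1 t) fun s => N.I k (A s ω) = 1
  · rw [playCount, Finset.card_filter, Nat.cast_sum]
    refine Finset.sum_congr rfl fun s _ => ?_
    rcases N.I_binary k (A s ω) with h | h <;> simp [h]

/-- The exponential supermartingale of the centred cumulative reward. -/
lemma integral_exp_rewardNoise_le (hS : N.IsStateSequence P S) (hG : IsArrivalSequence P S p G)
    (hist : ∀ t ∈ Finset.Icc 1 T, Measurable[ageHistory N S G A t] (A t)) (k : Fin K) (θ : ℝ)
    {t : ℕ} (h1 : 1 ≤ t) : t ≤ T + 1 →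
    Integrable (fun ω => Real.exp (θ * rewardNoise N S A k t ω
      - θ ^ 2 / 8 * playCount N A k t ω)) P ∧
    ∫ ω, Real.exp (θ * rewardNoise N S A k t ω - θ ^ 2 / 8 * playCount N A k t ω) ∂P ≤ 1 := by
  induction t, h1 using Nat.le_induction with
  | base => intro _; simp [rewardNoise, playCount]
  | succ t h1 ih =>
    intro hT
    obtain ⟨hi, hle⟩ := ih (by omega)
    set V : Ω → ℝ := fun ω => Real.exp (θ * rewardNoise N S A k t ω
      - θ ^ 2 / 8 * playCount N A k t ω) with hV
    set h : 𝒮 → ℝ := fun s => Real.exp (θ * (N.X k s - N.rate k) - θ ^ 2 / 8) with hh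
    have hVm : Measurable[past S G t] V :=
      Real.measurable_exp.comp (((measurable_rewardNoise_past hist k (by omega)).const_mul θ).sub
        ((measurable_playCount_past hist k (by omega)).const_mul (θ ^ 2 / 8)))
    have hIm : Measurable[past S G t] fun ω => N.I k (A t ω) :=
      (measurable_of_finite (N.I k)).comp (measurable_action_past hist h1 le_rfl (by omega))
    have hhm : Measurable h := by
      have := N.measurable_X k
      fun_prop
    have hle' := past_le hS hG t
    have hVI : Integrable (fun ω => V ω * N.I k (A t ω)) P := by
      refine hi.mono ((hVm.mul hIm).mono hle' le_rfl).aestronglyMeasurable (ae_of_all _ fun ω => ?_)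
      rcases N.I_binary k (A t ω) with h0 | h0 <;> simp [h0]
    have hhi : Integrable (fun ω => h (S t ω)) P := by
      refine integrable_of_abs_le (hhm.comp (hS.measurable t)) (Real.exp |θ|) fun ω => ?_
      rw [abs_of_pos (Real.exp_pos _)]
      refine Real.exp_le_exp.2 ?_
      have h0 := N.X_mem k (S t ω)
      have h2 := N.rate_nonneg k
      have h3 := N.rate_le_one k
      have : |N.X k (S t ω) - N.rate k| ≤ 1 := abs_le.2 ⟨by linarith [h0.1], by linarith [h0.2]⟩
      have h4 : θ * (N.X k (S t ω) - N.rate k) ≤ |θ| := (le_abs_self _).trans (by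
        rw [abs_mul]; exact mul_le_of_le_one_right (abs_nonneg _) this)
      nlinarith [sq_nonneg θ]
    have hVIh : Integrable (fun ω => V ω * N.I k (A t ω) * h (S t ω)) P :=
      (indepFun_of_indep (indep_past hS hG t) (hVm.mul hIm)
        (hhm.comp (comap_measurable (S t)))).integrable_mul hVI hhi
    -- Since `I` is `0` or `1`, the exponential is unchanged when the node is idle and multiplied by
    -- `h (S t)` when it is scheduled. The factor `V * I` is known before `S t`.
    have hstep : (fun ω => Real.exp (θ * rewardNoise N S A k (t + 1) ω
        - θ ^ 2 / 8 * playCount N A k (t + 1) ω)) =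
        fun ω => V ω - V ω * N.I k (A t ω) + V ω * N.I k (A t ω) * h (S t ω) := by
      funext ω
      have hM : rewardNoise N S A k (t + 1) ω = rewardNoise N S A k t ω
          + (N.X k (S t ω) - N.rate k) * N.I k (A t ω) := Finset.sum_Ico_succ_top h1 _
      rw [hM, playCount_succ k h1 ω]
      rcases N.I_binary k (A t ω) with h0 | h0
      · simp [h0, hV]
      · simp only [h0, hV, hh, mul_one, sub_self, zero_add]
        rw [← Real.exp_add]
        congr 1
        ring
    have i1 : Integrable (fun ω => V ω - V ω * N.I k (A t ω)) P := hi.sub hVI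
    rw [hstep]
    refine ⟨i1.add hVIh, ?_⟩
    rw [integral_add i1 hVIh, integral_sub hi hVI,
      integral_mul_comp_state hS hG (f := fun ω => V ω * N.I k (A t ω)) (hVm.mul hIm) hhm]
    have h5 : 0 ≤ ∫ ω, V ω * N.I k (A t ω) ∂P :=
      integral_nonneg fun ω => mul_nonneg (Real.exp_pos _).le (N.I_mem k (A t ω)).1
    have h6 := mul_le_of_le_one_right h5 (N.integral_exp_le_one k θ)
    linarith

/-- The event that the empirical mean of node `k` is off by the confidence radius in slot `t`,
from above for `σ = 1` and from below for `σ = -1`. -/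
def deviation (N : Network K 𝒮 𝒜) (S : ℕ → Ω → 𝒮) (A : ℕ → Ω → 𝒜) (σ : ℝ) (k : Fin K) (t : ℕ) :
    Set Ω :=
  {ω | playCount N A k t ω ≠ 0 ∧ playCount N A k t ω *
    Real.sqrt (3 * Real.log t / (2 * playCount N A k t ω)) ≤ σ * rewardNoise N S A k t ω}

omit [IsProbabilityMeasure P] in
lemma measurableSet_deviation (hS : N.IsStateSequence P S) (hG : IsArrivalSequence P S p G)
    (hist : ∀ t ∈ Finset.Icc 1 T, Measurable[ageHistory N S G A t] (A t)) (σ : ℝ) (k : Fin K)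
    {t : ℕ} (hT : t ≤ T + 1) : MeasurableSet (deviation N S A σ k t) := by
  have h1 := (measurable_playCount_past hist k hT).mono (past_le hS hG t) le_rfl
  have h2 := (measurable_rewardNoise_past hist k hT).mono (past_le hS hG t) le_rfl
  exact (h1 (measurableSet_singleton 0).compl).inter
    (measurableSet_le (h1.mul (((h1.const_mul 2).const_div _).sqrt)) (h2.const_mul σ))

/-- The play count is random, so a union bound runs over its fewer than `t` nonzero values; for each
of them Markov's inequality for the exponential supermartingale gives `t⁻³`. -/
lemma measureReal_deviation_le (hS : N.IsStateSequence P S) (hG : IsArrivalSequence P S p G)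
    (hist : ∀ t ∈ Finset.Icc 1 T, Measurable[ageHistory N S G A t] (A t)) {σ : ℝ} (hσ : σ ^ 2 = 1)
    (k : Fin K) {t : ℕ} (h1 : 1 ≤ t) (hT : t ≤ T + 1) :
    P.real (deviation N S A σ k t) ≤ 1 / (t : ℝ) ^ 2 := by
  have ht : (1 : ℝ) ≤ t := by exact_mod_cast h1
  have hlog : 0 ≤ Real.log t := Real.log_nonneg ht
  have hexp : Real.exp (3 * Real.log t) = (t : ℝ) ^ 3 := by
    rw [show (3 : ℝ) * Real.log t = ((3 : ℕ) : ℝ) * Real.log t by norm_num, Real.exp_nat_mul,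
      Real.exp_log (by linarith)]
  have hsub : deviation N S A σ k t ⊆ ⋃ n ∈ Finset.Icc 1 (t - 1),
      deviation N S A σ k t ∩ {ω | playCount N A k t ω = n} := by
    intro ω hω
    obtain ⟨n, hn, he⟩ := exists_playCount_eq (N := N) (A := A) k t ω
    have h0 : n ≠ 0 := fun h => hω.1 (by rw [he, h, Nat.cast_zero])
    simp only [Set.mem_iUnion]
    exact ⟨n, Finset.mem_Icc.2 ⟨by omega, hn⟩, hω, he⟩
  have hone : ∀ n ∈ Finset.Icc 1 (t - 1),
      P.real (deviation N S A σ k t ∩ {ω | playCount N A k t ω = n}) ≤ 1 / (t : ℝ) ^ 3 := by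
    intro n hn
    rw [Finset.mem_Icc] at hn
    have hn0 : (0 : ℝ) < n := by exact_mod_cast hn.1
    set w := Real.sqrt (3 * Real.log t / (2 * n)) with hw
    have hw2 : w ^ 2 = 3 * Real.log t / (2 * n) := Real.sq_sqrt (by positivity)
    -- The value `4w` maximizes `θnw - θ²n/8`; the maximum is `2nw² = 3 log t`, whence the threshold
    -- `t³`.
    obtain ⟨hi, hle⟩ := integral_exp_rewardNoise_le hS hG hist k (4 * w * σ) h1 hT
    have hM := mul_meas_ge_le_integral_of_nonneg (ae_of_all P fun ω => (Real.exp_pos _).le) hi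
      ((t : ℝ) ^ 3)
    have hmono : P.real (deviation N S A σ k t ∩ {ω | playCount N A k t ω = n}) ≤
        P.real {ω | (t : ℝ) ^ 3 ≤ Real.exp (4 * w * σ * rewardNoise N S A k t ω
          - (4 * w * σ) ^ 2 / 8 * playCount N A k t ω)} := by
      refine measureReal_mono ?_
      rintro ω ⟨⟨-, h2⟩, h3⟩
      simp only [Set.mem_ofPred_eq] at h3 ⊢
      rw [h3, ← hw] at h2
      rw [h3, ← hexp]
      refine Real.exp_le_exp.2 ?_
      have h4 : 4 * w * (n * w) ≤ 4 * w * (σ * rewardNoise N S A k t ω) :=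
        mul_le_mul_of_nonneg_left h2 (by positivity)
      have h5 : (n : ℝ) * w ^ 2 = 3 * Real.log t / 2 := by rw [hw2]; field_simp
      have h6 : (4 * w * σ) ^ 2 / 8 * n = 2 * (n * w ^ 2) := by
        rw [mul_pow, hσ]; ring
      rw [h6]
      linarith
    rw [le_div_iff₀ (by positivity)]
    calc _ ≤ _ := mul_le_mul_of_nonneg_right hmono (by positivity)
      _ ≤ 1 := by rw [mul_comm]; exact hM.trans hle
  calc P.real (deviation N S A σ k t)
      ≤ P.real (⋃ n ∈ Finset.Icc 1 (t - 1),
        deviation N S A σ k t ∩ {ω | playCount N A k t ω = n}) :=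
        measureReal_mono hsub (measure_ne_top P _)
    _ ≤ ∑ n ∈ Finset.Icc 1 (t - 1), P.real (deviation N S A σ k t ∩ {ω | playCount N A k t ω = n}) :=
        measureReal_biUnion_finset_le _ _
    _ ≤ ∑ n ∈ Finset.Icc 1 (t - 1), 1 / (t : ℝ) ^ 3 := Finset.sum_le_sum hone
    _ = ((t - 1 : ℕ) : ℝ) / (t : ℝ) ^ 3 := by simp; ring
    _ ≤ t / (t : ℝ) ^ 3 := by gcongr; omega
    _ = _ := by field_simp

/-- The total expected number of slots with a deviation. -/
lemma sum_measureReal_deviation_le (hS : N.IsStateSequence P S) (hG : IsArrivalSequence P S p G)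
    (hist : ∀ t ∈ Finset.Icc 1 T, Measurable[ageHistory N S G A t] (A t)) {σ : ℝ} (hσ : σ ^ 2 = 1)
    (k : Fin K) : ∑ t ∈ Finset.Icc 1 T, P.real (deviation N S A σ k t) ≤ Real.pi ^ 2 / 6 := by
  refine (Finset.sum_le_sum fun t ht => ?_).trans (sum_le_hasSum (Finset.Icc 1 T)
    (fun t _ => by positivity) hasSum_zeta_two)
  rw [Finset.mem_Icc] at ht
  exact measureReal_deviation_le hS hG hist hσ k ht.1 (by omega)

omit mΩ [MeasurableSpace 𝒜] [MeasurableSingletonClass 𝒜] [Fintype 𝒜] in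
lemma ucb_le_one (k : Fin K) (t : ℕ) (ω : Ω) : ucb N S A k t ω ≤ 1 := by
  rw [ucb]
  split_ifs
  · exact le_rfl
  · exact min_le_left _ _

omit mΩ [MeasurableSpace 𝒜] [MeasurableSingletonClass 𝒜] [Fintype 𝒜] in
lemma ucb_nonneg (k : Fin K) (t : ℕ) (ω : Ω) : 0 ≤ ucb N S A k t ω := by
  rw [ucb]
  split_ifs
  · exact zero_le_one
  · refine le_min zero_le_one (add_nonneg (div_nonneg (Finset.sum_nonneg fun s _ => ?_)
      (playCount_nonneg k t ω)) (Real.sqrt_nonneg _))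
    rcases N.R_eq_zero_or_one k (S s ω) (A s ω) with h | h <;> simp [h]

omit mΩ [MeasurableSpace 𝒜] [MeasurableSingletonClass 𝒜] [Fintype 𝒜] in
lemma empiricalMean_eq (k : Fin K) (t : ℕ) (ω : Ω) (h : playCount N A k t ω ≠ 0) :
    empiricalMean N S A k t ω = rewardNoise N S A k t ω / playCount N A k t ω + N.rate k := by
  rw [empiricalMean, sum_reward_eq]
  field_simp

omit mΩ [MeasurableSpace 𝒜] [MeasurableSingletonClass 𝒜] [Fintype 𝒜] in
-- Truncation at `1` and the default value `1` keep the optimism because a channel rate never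
-- exceeds `1`.
lemma rate_le_ucb (k : Fin K) (t : ℕ) (ω : Ω) (h : ω ∉ deviation N S A (-1) k t) :
    N.rate k ≤ ucb N S A k t ω := by
  rw [ucb]
  split_ifs with h0
  · exact N.rate_le_one k
  · refine le_min (N.rate_le_one k) ?_
    have hpos : 0 < playCount N A k t ω := lt_of_le_of_ne (playCount_nonneg k t ω) (Ne.symm h0)
    have h1 : ¬ (playCount N A k t ω * Real.sqrt (3 * Real.log t / (2 * playCount N A k t ω)) ≤
      -1 * rewardNoise N S A k t ω) := fun h1 => h ⟨h0, h1⟩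
    rw [empiricalMean_eq k t ω h0]
    have h2 : -Real.sqrt (3 * Real.log t / (2 * playCount N A k t ω)) ≤
        rewardNoise N S A k t ω / playCount N A k t ω := by
      rw [le_div_iff₀ hpos]
      nlinarith
    linarith

omit mΩ [MeasurableSpace 𝒜] [MeasurableSingletonClass 𝒜] [Fintype 𝒜] in
lemma ucb_sub_rate_le (k : Fin K) (t : ℕ) (ω : Ω) (h : ω ∉ deviation N S A 1 k t)
    (h0 : playCount N A k t ω ≠ 0) :
    ucb N S A k t ω - N.rate k ≤ Real.sqrt (6 * Real.log t / playCount N A k t ω) := by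
  have hpos : 0 < playCount N A k t ω := lt_of_le_of_ne (playCount_nonneg k t ω) (Ne.symm h0)
  have h1 : ¬ (playCount N A k t ω * Real.sqrt (3 * Real.log t / (2 * playCount N A k t ω)) ≤
      1 * rewardNoise N S A k t ω) := fun h1 => h ⟨h0, h1⟩
  have h2 : rewardNoise N S A k t ω / playCount N A k t ω ≤
      Real.sqrt (3 * Real.log t / (2 * playCount N A k t ω)) := by
    rw [div_le_iff₀ hpos]
    linarith
  have h3 : Real.sqrt (6 * Real.log t / playCount N A k t ω) =
      2 * Real.sqrt (3 * Real.log t / (2 * playCount N A k t ω)) := by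
    rw [show 6 * Real.log t / playCount N A k t ω =
      2 ^ 2 * (3 * Real.log t / (2 * playCount N A k t ω)) by field_simp; ring,
      Real.sqrt_mul (by norm_num), Real.sqrt_sq (by norm_num)]
  rw [ucb, if_neg h0, h3]
  have h4 := min_le_right 1 (empiricalMean N S A k t ω +
    Real.sqrt (3 * Real.log t / (2 * playCount N A k t ω)))
  rw [empiricalMean_eq k t ω h0] at h4 ⊢
  linarith

end Concentration

/-! ### Summing the exploration bonuses. -/

section Counting

/-- The total exploration bonus of one node: the first play costs at most `1`, and a play after
`n ≥ 1` earlier ones at most `√(L / n)`. -/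
lemma sum_bonus_le {i b : ℕ → ℝ} {L : ℝ} (hL : 0 ≤ L) (hi : ∀ t, i t = 0 ∨ i t = 1) {T : ℕ}
    (hb0 : ∀ t ∈ Finset.Icc 1 T, b t ≤ 1)
    (hb : ∀ t ∈ Finset.Icc 1 T, ∑ s ∈ Finset.Ico 1 t, i s ≠ 0 →
      b t ≤ Real.sqrt (L / ∑ s ∈ Finset.Ico 1 t, i s)) :
    ∑ t ∈ Finset.Icc 1 T, i t * b t ≤ min (∑ s ∈ Finset.Icc 1 T, i s) 1
      + 2 * Real.sqrt (L * ∑ s ∈ Finset.Icc 1 T, i s) := by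
  -- After the first play, which is charged `1`, only the remaining plays enter the root; hence the
  -- `- 1` under it.
  have key : ∀ n ≤ T, (∑ s ∈ Finset.Icc 1 n, i s = 0 ∧ ∑ t ∈ Finset.Icc 1 n, i t * b t ≤ 0) ∨
      (1 ≤ ∑ s ∈ Finset.Icc 1 n, i s ∧ ∑ t ∈ Finset.Icc 1 n, i t * b t ≤
        1 + 2 * (Real.sqrt L * Real.sqrt (∑ s ∈ Finset.Icc 1 n, i s - 1))) := by
    intro n
    induction n with
    | zero => intro _; left; simp
    | succ n ih =>
      intro hn
      have hmem : n + 1 ∈ Finset.Icc 1 T := Finset.mem_Icc.2 ⟨by omega, hn⟩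
      have hIco : Finset.Ico 1 (n + 1) = Finset.Icc 1 n := rfl
      have hb0 := hb0 (n + 1) hmem
      have hb := hb (n + 1) hmem
      rw [hIco] at hb
      rw [Finset.sum_Icc_succ_top (by omega), Finset.sum_Icc_succ_top (by omega)]
      rcases hi (n + 1) with h | h
      · simpa [h] using ih (by omega)
      · right
        rw [h, one_mul]
        rcases ih (by omega) with ⟨h1, h2⟩ | ⟨h1, h2⟩
        · rw [h1]
          refine ⟨by norm_num, ?_⟩
          simp
          linarith
        · set m := ∑ s ∈ Finset.Icc 1 n, i s
          refine ⟨by linarith, ?_⟩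
          have h3 := hb (by linarith)
          rw [Real.sqrt_div hL] at h3
          have h4 : 0 < Real.sqrt m := Real.sqrt_pos.2 (by linarith)
          have h5 : 1 / Real.sqrt m ≤ 2 * (Real.sqrt m - Real.sqrt (m - 1)) := by
            rw [div_le_iff₀ h4]
            have h6 := Real.sq_sqrt (show 0 ≤ m by linarith)
            have h7 := Real.sq_sqrt (show 0 ≤ m - 1 by linarith)
            nlinarith [sq_nonneg (Real.sqrt m - Real.sqrt (m - 1))]
          have h6 := mul_le_mul_of_nonneg_left h5 (Real.sqrt_nonneg L)
          rw [add_sub_cancel_right]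
          have h7 : Real.sqrt L / Real.sqrt m = Real.sqrt L * (1 / Real.sqrt m) := by ring
          linarith
  rcases key T le_rfl with ⟨h1, h2⟩ | ⟨h1, h2⟩
  · rw [h1]
    simpa using h2
  · rw [min_eq_right h1, Real.sqrt_mul hL]
    refine h2.trans ?_
    gcongr
    linarith

/-- Summation of the bonuses over the nodes. -/
lemma sum_min_add_sqrt_le {K : ℕ} {n : Fin K → ℝ} (hn : ∀ k, 0 ≤ n k) {Y x : ℝ} (hY : ∑ k, n k ≤ Y)
    (hx : 1 / 2 ≤ x) :
    ∑ k, (min (n k) 1 + 2 * Real.sqrt (6 * x * n k)) ≤ Real.sqrt (56 * K * Y * x) := by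
  have hs : 0 ≤ ∑ k, n k := Finset.sum_nonneg fun k _ => hn k
  -- The sum is at most `K` and at most `Y`, so its square is at most `K * Y`.
  have h1 : ∑ k, min (n k) 1 ≤ Real.sqrt (K * Y) := by
    refine Real.le_sqrt_of_sq_le ?_
    rw [sq]
    refine mul_le_mul ?_ ((Finset.sum_le_sum fun k _ => min_le_left _ _).trans hY)
      (Finset.sum_nonneg fun k _ => le_min (hn k) zero_le_one) (Nat.cast_nonneg _)
    refine (Finset.sum_le_sum fun k _ => min_le_right _ _).trans ?_
    simp
  have h2 : ∑ k, Real.sqrt (6 * x * n k) ≤ Real.sqrt (6 * x) * Real.sqrt (K * Y) := by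
    have h3 := Real.sum_sqrt_mul_sqrt_le Finset.univ (f := fun _ : Fin K => (1 : ℝ)) (g := n)
      (fun _ => zero_le_one) hn
    simp only [Real.sqrt_one, one_mul, Finset.sum_const, Finset.card_univ, Fintype.card_fin,
      nsmul_eq_mul, mul_one] at h3
    simp_rw [Real.sqrt_mul (show 0 ≤ 6 * x by linarith)]
    rw [← Finset.mul_sum, Real.sqrt_mul (Nat.cast_nonneg _)]
    refine mul_le_mul_of_nonneg_left (h3.trans ?_) (Real.sqrt_nonneg _)
    exact mul_le_mul_of_nonneg_left (Real.sqrt_le_sqrt hY) (Real.sqrt_nonneg _)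
  rw [Finset.sum_add_distrib, ← Finset.mul_sum]
  -- With `2√(6x) ≤ 6x + 1` the square of the left side is at most `36x + 3`, and `3 ≤ 6x`.
  have h4 : 1 + 2 * Real.sqrt (6 * x) ≤ Real.sqrt (56 * x) := by
    refine Real.le_sqrt_of_sq_le ?_
    have h5 := Real.sq_sqrt (show 0 ≤ 6 * x by linarith)
    nlinarith [sq_nonneg (Real.sqrt (6 * x) - 1)]
  calc _ ≤ Real.sqrt (K * Y) * (1 + 2 * Real.sqrt (6 * x)) := by linarith
    _ ≤ Real.sqrt (K * Y) * Real.sqrt (56 * x) := mul_le_mul_of_nonneg_left h4 (Real.sqrt_nonneg _)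
    _ = _ := by
      rw [← Real.sqrt_mul (mul_nonneg (Nat.cast_nonneg _) (hs.trans hY))]
      congr 1
      ring

end Counting

end AgeBandit

namespace AgeBandit

/-! ### Existence and feasibility of the optimal static policy. -/

section Static

variable {K : ℕ} {𝒮 𝒜 : Type u} [MeasurableSpace 𝒮] [MeasurableSpace 𝒜]
  [MeasurableSingletonClass 𝒜] [Fintype 𝒜] {N : Network K 𝒮 𝒜} {T W : ℕ} {χ : Fin K → ℝ}

omit [MeasurableSpace 𝒜] [MeasurableSingletonClass 𝒜] in
lemma sum_toReal_eq_one (σ : PMF 𝒜) : ∑ a, (σ a).toReal = 1 := by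
  rw [← ENNReal.toReal_sum fun a _ => σ.apply_ne_top a, ← tsum_fintype (L := .unconditional 𝒜), σ.tsum_coe,
    ENNReal.toReal_one]

lemma staticThroughput_eq (N : Network K 𝒮 𝒜) (σ : PMF 𝒜) (k : Fin K) :
    N.staticThroughput σ k = N.rate k * ∑ a, (σ a).toReal * N.I k a := by
  have := N.isProbabilityMeasure_law
  rw [Network.staticThroughput]
  simp only [Network.R]
  rw [integral_prod_mul (N.X k) (N.I k), PMF.integral_eq_sum]
  rfl

/-- The distribution of the action in a random variable's law. -/
lemma integral_comp_action {Ω : Type*} [MeasurableSpace Ω] {P : Measure Ω} [IsProbabilityMeasure P]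
    {a : Ω → 𝒜} (ha : Measurable a) (f : 𝒜 → ℝ) :
    ∫ ω, f (a ω) ∂P = ∑ b, P.real {ω | a ω = b} * f b := by
  have := Measure.isProbabilityMeasure_map (μ := P) ha.aemeasurable
  rw [← integral_map (φ := a) (f := f) ha.aemeasurable
      (measurable_of_finite f).aestronglyMeasurable,
    integral_fintype (Integrable.of_finite)]
  refine Finset.sum_congr rfl fun b _ => ?_
  rw [map_measureReal_apply ha (measurableSet_singleton b), smul_eq_mul]
  rfl

namespace CausalPolicy

/-- As `A t` is independent of `S t`, only its marginal law matters. Value and constraints thus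
become linear in `π.prob`. -/
lemma integral_reward_eq (π : CausalPolicy N T) (k : Fin K) {t : ℕ} (ht : t ∈ Finset.Icc 1 T) :
    letI := π.mΩ
    ∫ ω, N.R k (π.S t ω) (π.A t ω) ∂π.P = N.rate k * ∑ a, π.prob t a * N.I k a := by
  let _ := π.mΩ
  have := π.isProbabilityMeasure_P
  have hA := π.measurable_A t ht
  have hS := π.isStateSequence.measurable t
  have hind : IndepFun (fun ω => N.X k (π.S t ω)) (fun ω => N.I k (π.A t ω)) π.P :=
    (π.indep t ht t le_rfl).symm.comp (N.measurable_X k) (measurable_of_finite (N.I k))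
  simp only [Network.R]
  rw [hind.integral_fun_mul_eq_mul_integral ((N.measurable_X k).comp hS).aestronglyMeasurable
    ((measurable_of_finite (N.I k)).comp hA).aestronglyMeasurable,
    integral_comp_state π.isStateSequence (N.measurable_X k), integral_comp_action hA]
  rfl

lemma integrable_reward (π : CausalPolicy N T) (k : Fin K) {t : ℕ} (ht : t ∈ Finset.Icc 1 T) :
    letI := π.mΩ
    Integrable (fun ω => N.R k (π.S t ω) (π.A t ω)) π.P := by
  let _ := π.mΩ
  have := π.isProbabilityMeasure_P
  refine integrable_of_abs_le (N.measurable_reward k (π.isStateSequence.measurable t)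
    (π.measurable_A t ht)) 1 fun ω => ?_
  rcases N.R_eq_zero_or_one k (π.S t ω) (π.A t ω) with h | h <;> simp [h]

lemma value_eq (π : CausalPolicy N T) :
    π.value = ∑ k, ∑ t ∈ Finset.Icc 1 T, N.rate k * ∑ a, π.prob t a * N.I k a :=
  Finset.sum_congr rfl fun k _ => Finset.sum_congr rfl fun _ ht => π.integral_reward_eq k ht

lemma windowThroughput_eq (π : CausalPolicy N T) (W : ℕ) (k : Fin K) {t : ℕ}
    (ht : t ∈ Finset.Icc W T) :
    π.windowThroughput W k t =
      1 / (W : ℝ) * ∑ s ∈ Finset.Icc (t + 1 - W) t, N.rate k * ∑ a, π.prob s a * N.I k a := by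
  have hmem : ∀ s ∈ Finset.Icc (t + 1 - W) t, s ∈ Finset.Icc 1 T := fun s hs => by
    rw [Finset.mem_Icc] at *
    omega
  rw [windowThroughput, integral_const_mul,
    integral_finsetSum _ fun s hs => π.integrable_reward k (hmem s hs)]
  congr 1
  exact Finset.sum_congr rfl fun s hs => π.integral_reward_eq k (hmem s hs)

end CausalPolicy

/-- A lower bound on the average over all windows passes to disjoint unions of windows. -/
lemma mul_le_sum_Icc {f : ℕ → ℝ} {c : ℝ} {W : ℕ} (hW : 1 ≤ W) (m : ℕ)
    (h : ∀ t ∈ Finset.Icc W (W * m), c ≤ 1 / (W : ℝ) * ∑ s ∈ Finset.Icc (t + 1 - W) t, f s) :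
    (W * m : ℕ) * c ≤ ∑ s ∈ Finset.Icc 1 (W * m), f s := by
  induction m with
  | zero => simp
  | succ m ih =>
    have hmul : W * (m + 1) = W * m + W := Nat.mul_succ W m
    have h1 := ih fun t ht => h t (by rw [Finset.mem_Icc] at *; omega)
    have h2 := h (W * (m + 1)) (by rw [Finset.mem_Icc]; constructor <;> nlinarith)
    rw [hmul] at h2 ⊢
    have hsplit : ∑ s ∈ Finset.Icc 1 (W * m + W), f s = ∑ s ∈ Finset.Icc 1 (W * m), f s +
        ∑ s ∈ Finset.Icc (W * m + W + 1 - W) (W * m + W), f s := by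
      have e1 : Finset.Icc 1 (W * m) = Finset.Ico 1 (W * m + 1) := rfl
      have e2 : Finset.Icc 1 (W * m + W) = Finset.Ico 1 (W * m + W + 1) := rfl
      have e3 : Finset.Icc (W * m + W + 1 - W) (W * m + W) =
          Finset.Ico (W * m + 1) (W * m + W + 1) := by
        rw [show W * m + W + 1 - W = W * m + 1 by omega]
        rfl
      rw [e1, e2, e3, Finset.sum_Ico_consecutive f (by omega) (by omega)]
    rw [hsplit]
    have hW' : (0 : ℝ) < W := by exact_mod_cast hW
    rw [one_div, le_inv_mul_iff₀ hW'] at h2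
    push_cast at h1 ⊢
    linarith

/-- The time average of a feasible causal policy satisfies the constraints in every slot. -/
lemma CausalPolicy.IsFeasible.mul_le_sum {π : CausalPolicy N T} (hπ : π.IsFeasible χ W)
    (hW : 1 ≤ W) (hWT : W ∣ T) (k : Fin K) :
    T * χ k ≤ ∑ t ∈ Finset.Icc 1 T, N.rate k * ∑ a, π.prob t a * N.I k a := by
  obtain ⟨m, rfl⟩ := hWT
  exact mul_le_sum_Icc hW m fun t ht => (hπ k t ht).trans (π.windowThroughput_eq W k ht).le

omit [MeasurableSpace 𝒜] [MeasurableSingletonClass 𝒜] in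
lemma sum_average_mul (p : ℕ → 𝒜 → ℝ) (f : 𝒜 → ℝ) :
    ∑ a, (1 / (T : ℝ) * ∑ t ∈ Finset.Icc 1 T, p t a) * f a =
      1 / (T : ℝ) * ∑ t ∈ Finset.Icc 1 T, ∑ a, p t a * f a := by
  rw [Finset.sum_comm, Finset.mul_sum]
  refine Finset.sum_congr rfl fun a _ => ?_
  rw [mul_assoc, Finset.sum_mul]

/-- An optimal static policy satisfies the throughput requirements. -/
lemma le_staticThroughput (hT : 1 ≤ T) (hW : 1 ≤ W) (hWT : W ∣ T) {σ : PMF 𝒜}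
    (hσ : IsOptimalStatic N χ T W σ) (k : Fin K) : χ k ≤ N.staticThroughput σ k := by
  obtain ⟨π, ⟨hπ, -⟩, hav⟩ := hσ
  have h := hπ.mul_le_sum hW hWT k
  rw [staticThroughput_eq]
  simp_rw [hav]
  rw [sum_average_mul]
  have hT' : (0 : ℝ) < T := by exact_mod_cast hT
  rw [← Finset.mul_sum] at h
  rw [mul_left_comm, one_div, le_inv_mul_iff₀ hT']
  exact h

omit [MeasurableSingletonClass 𝒜] [Fintype 𝒜] in
lemma map_eval_prod_infinitePi (μ : Measure 𝒮) [IsProbabilityMeasure μ] (ν : Measure 𝒜)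
    [IsProbabilityMeasure ν] (t : ℕ) :
    ((Measure.infinitePi fun _ : ℕ => μ).prod ν).map (fun ω => ω.1 t) = μ := by
  have h : (fun ω : (ℕ → 𝒮) × 𝒜 => ω.1 t) = (fun x : ℕ → 𝒮 => x t) ∘ Prod.fst := rfl
  rw [h, ← Measure.map_map (measurable_pi_apply t) measurable_fst, Measure.map_fst_prod,
    measure_univ, one_smul, Measure.infinitePi_map_eval]

/-- The static policy that plays one and the same random action in all slots. -/
@[reducible]
noncomputable def staticPolicy (N : Network K 𝒮 𝒜) (T : ℕ) (σ : PMF 𝒜) : CausalPolicy N T :=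
  letI := N.isProbabilityMeasure_law
  { Ω := (ℕ → 𝒮) × 𝒜
    mΩ := inferInstance
    P := (Measure.infinitePi fun _ : ℕ => N.law).prod σ.toMeasure
    isProbabilityMeasure_P := inferInstance
    S := fun t ω => ω.1 t
    A := fun _ ω => ω.2
    isStateSequence :=
      { measurable := fun t => (measurable_pi_apply t).comp measurable_fst
        law_eq := map_eval_prod_infinitePi N.law σ.toMeasure
        indep := by
          have hm : ∀ t : ℕ, Measurable fun ω : (ℕ → 𝒮) × 𝒜 => ω.1 t :=
            fun t => (measurable_pi_apply t).comp measurable_fst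
          rw [iIndepFun_iff_map_fun_eq_infinitePi_map hm]
          simp_rw [map_eval_prod_infinitePi N.law σ.toMeasure]
          change Measure.map Prod.fst _ = _
          rw [Measure.map_fst_prod, measure_univ, one_smul] }
    measurable_A := fun _ _ => measurable_snd
    indep := fun t _ s _ =>
      (indepFun_prod (X := fun x : ℕ → 𝒮 => x s) (Y := fun a : 𝒜 => a)
        (measurable_pi_apply s) measurable_id).symm }

lemma prob_staticPolicy (N : Network K 𝒮 𝒜) (T : ℕ) (σ : PMF 𝒜) (t : ℕ) (a : 𝒜) :
    (staticPolicy N T σ).prob t a = (σ a).toReal := by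
  have := N.isProbabilityMeasure_law
  have h : {ω : (ℕ → 𝒮) × 𝒜 | ω.2 = a} = Set.univ ×ˢ {a} := by ext ω; simp
  simp only [CausalPolicy.prob]
  rw [measureReal_def, h, Measure.prod_prod, measure_univ, one_mul,
    PMF.toMeasure_apply_singleton _ _ (measurableSet_singleton a)]

lemma CausalPolicy.sum_prob (π : CausalPolicy N T) {t : ℕ} (ht : t ∈ Finset.Icc 1 T) :
    ∑ a, π.prob t a = 1 := by
  let _ := π.mΩ
  have := π.isProbabilityMeasure_P
  have h := integral_comp_action (P := π.P) (π.measurable_A t ht) fun _ => (1 : ℝ)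
  simp only [integral_const, probReal_univ, smul_eq_mul, mul_one] at h
  exact h.symm

omit [MeasurableSingletonClass 𝒜] [Fintype 𝒜] in
lemma CausalPolicy.prob_nonneg (π : CausalPolicy N T) (t : ℕ) (a : 𝒜) : 0 ≤ π.prob t a := by
  let _ := π.mΩ
  exact measureReal_nonneg

/-- The one-slot reward is maximized over the compact set of distributions meeting the constraints.
The maximizer, played statically, beats every feasible policy: when `W` divides `T`, disjoint
windows tile the horizon, so the time average of that policy lies in the same set and has the same
mean reward per slot. -/
theorem exists_isOptimalStatic (hT : 1 ≤ T) (hW : 1 ≤ W) (hWT : W ∣ T)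
    (hf : ∃ σ : PMF 𝒜, ∀ k, χ k ≤ N.staticThroughput σ k) :
    ∃ σ : PMF 𝒜, IsOptimalStatic N χ T W σ := by
  obtain ⟨σ₀, hσ₀⟩ := hf
  have hT' : (0 : ℝ) < T := by exact_mod_cast hT
  have hW' : (0 : ℝ) < W := by exact_mod_cast hW
  let g : Fin K → (𝒜 → ℝ) → ℝ := fun k w => N.rate k * ∑ a, w a * N.I k a
  have hg : ∀ k, Continuous (g k) := fun k => by fun_prop
  have hC : IsCompact (stdSimplex ℝ 𝒜 ∩ {w | ∀ k, χ k ≤ g k w}) := by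
    refine (isCompact_stdSimplex ℝ 𝒜).inter_right ?_
    rw [show {w | ∀ k, χ k ≤ g k w} = ⋂ k, {w | χ k ≤ g k w} by ext w; simp]
    exact isClosed_iInter fun k => isClosed_le continuous_const (hg k)
  obtain ⟨w, ⟨⟨hw0, hw1⟩, hwχ⟩, hmax⟩ := hC.exists_isMaxOn
    ⟨fun a => (σ₀ a).toReal, ⟨fun a => ENNReal.toReal_nonneg, sum_toReal_eq_one σ₀⟩, fun k => by
      simpa [g, staticThroughput_eq] using hσ₀ k⟩
    (continuous_finsetSum Finset.univ fun k _ => hg k).continuousOn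
  let σ : PMF 𝒜 := PMF.ofFintype (fun a => ENNReal.ofReal (w a)) (by
    rw [← ENNReal.ofReal_sum_of_nonneg fun a _ => hw0 a, hw1, ENNReal.ofReal_one])
  have hσ : ∀ a, (σ a).toReal = w a := fun a => by
    rw [PMF.ofFintype_apply, ENNReal.toReal_ofReal (hw0 a)]
  refine ⟨σ, staticPolicy N T σ, ⟨fun k t ht => ?_, fun π hπ => ?_⟩, fun a => ?_⟩
  · rw [CausalPolicy.windowThroughput_eq _ W k ht]
    simp_rw [prob_staticPolicy, hσ]
    rw [Finset.mem_Icc] at ht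
    rw [Finset.sum_const, Nat.card_Icc, show t + 1 - (t + 1 - W) = W by omega, nsmul_eq_mul,
      one_div, inv_mul_cancel_left₀ hW'.ne']
    exact hwχ k
  · have hmem : (fun a => 1 / (T : ℝ) * ∑ t ∈ Finset.Icc 1 T, π.prob t a) ∈
        stdSimplex ℝ 𝒜 ∩ {w | ∀ k, χ k ≤ g k w} := by
      refine ⟨⟨fun a => mul_nonneg (by positivity)
        (Finset.sum_nonneg fun t _ => π.prob_nonneg t a), ?_⟩, fun k => ?_⟩
      · rw [← Finset.mul_sum, Finset.sum_comm, Finset.sum_congr rfl fun t ht => π.sum_prob ht]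
        simp [hT'.ne']
      · have h := hπ.mul_le_sum hW hWT k
        rw [← Finset.mul_sum] at h
        simp only [g]
        rw [sum_average_mul, mul_left_comm, one_div, le_inv_mul_iff₀ hT']
        exact h
    have h := hmax hmem
    simp only [Set.mem_ofPred_eq, g, sum_average_mul] at h
    rw [CausalPolicy.value_eq, CausalPolicy.value_eq]
    simp_rw [prob_staticPolicy, hσ, Finset.sum_const, Nat.card_Icc, Nat.add_sub_cancel,
      nsmul_eq_mul, ← Finset.mul_sum]
    refine le_trans (le_of_eq ?_) (mul_le_mul_of_nonneg_left h hT'.le)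
    rw [Finset.mul_sum]
    refine Finset.sum_congr rfl fun k _ => ?_
    field_simp
  · simp_rw [prob_staticPolicy]
    simp [hT'.ne']

end Static

end AgeBandit

namespace AgeBandit

/-! ### Regret against a static policy with slack. -/

section Regret

variable {K : ℕ} {𝒮 𝒜 : Type u} [MeasurableSpace 𝒮] [MeasurableSpace 𝒜]
  [MeasurableSingletonClass 𝒜] [Fintype 𝒜] {N : Network K 𝒮 𝒜} {T : ℕ} {χ : Fin K → ℝ}
  {η ε γ : ℝ} {Ω : Type v} [MeasurableSpace Ω] {P : Measure Ω} [IsProbabilityMeasure P]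
  {S : ℕ → Ω → 𝒮} {G : Fin K → ℕ → Ω → ℕ} {A : ℕ → Ω → 𝒜}

omit [MeasurableSpace 𝒜] [MeasurableSingletonClass 𝒜] in
lemma Network.sum_I_le_Imax (N : Network K 𝒮 𝒜) (a : 𝒜) : ∑ k, N.I k a ≤ N.Imax :=
  le_ciSup (f := fun a => ∑ k, N.I k a) (Set.finite_range _).bddAbove a

omit [MeasurableSpace 𝒜] [MeasurableSingletonClass 𝒜] [Fintype 𝒜] in
lemma Network.Imax_nonneg (N : Network K 𝒮 𝒜) : 0 ≤ N.Imax :=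
  Real.iSup_nonneg fun a => Finset.sum_nonneg fun k _ => (N.I_mem k a).1

/-- The cost of overestimating a channel rate in one slot, unless there is a deviation. -/
noncomputable def bonus (N : Network K 𝒮 𝒜) (S : ℕ → Ω → 𝒮) (A : ℕ → Ω → 𝒜) (k : Fin K) (t : ℕ)
    (ω : Ω) : ℝ :=
  open Classical in if ω ∈ deviation N S A 1 k t then 0 else ucb N S A k t ω - N.rate k

omit [MeasurableSpace 𝒜] [MeasurableSingletonClass 𝒜] [MeasurableSpace Ω] in
lemma sum_bonus_run_le (hT : 2 ≤ T) (ω : Ω) :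
    ∑ k, ∑ t ∈ Finset.Icc 1 T, N.I k (A t ω) * bonus N S A k t ω ≤
      Real.sqrt (56 * K * N.Imax * T * Real.log T) := by
  have hT' : (2 : ℝ) ≤ T := by exact_mod_cast hT
  have hlog : 1 / 2 ≤ Real.log T := by
    have := Real.log_two_gt_d9
    have := Real.log_le_log (by norm_num) hT'
    linarith
  have h1 : ∀ k, ∑ t ∈ Finset.Icc 1 T, N.I k (A t ω) * bonus N S A k t ω ≤
      min (∑ s ∈ Finset.Icc 1 T, N.I k (A s ω)) 1
        + 2 * Real.sqrt (6 * Real.log T * ∑ s ∈ Finset.Icc 1 T, N.I k (A s ω)) := by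
    intro k
    refine sum_bonus_le (i := fun t => N.I k (A t ω)) (b := fun t => bonus N S A k t ω)
      (by linarith) (fun t => N.I_binary k _) (fun t _ => ?_) (fun t ht h0 => ?_)
    · rw [bonus]
      split_ifs
      · exact zero_le_one
      · linarith [ucb_le_one (N := N) (S := S) (A := A) k t ω, N.rate_nonneg k]
    · rw [Finset.mem_Icc] at ht
      rw [bonus]
      split_ifs with hd
      · exact Real.sqrt_nonneg _
      · refine (ucb_sub_rate_le k t ω hd h0).trans (Real.sqrt_le_sqrt ?_)
        have ht1 : (0 : ℝ) < t := by exact_mod_cast ht.1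
        have htT : (t : ℝ) ≤ T := by exact_mod_cast ht.2
        exact div_le_div_of_nonneg_right
          (mul_le_mul_of_nonneg_left (Real.log_le_log ht1 htT) (by norm_num))
          (playCount_nonneg k t ω)
  refine (Finset.sum_le_sum fun k _ => h1 k).trans ((sum_min_add_sqrt_le (Y := N.Imax * T)
    (fun k => Finset.sum_nonneg fun s _ => (N.I_mem k _).1) ?_ hlog).trans_eq ?_)
  · rw [Finset.sum_comm]
    refine (Finset.sum_le_sum fun t _ => N.sum_I_le_Imax (A t ω)).trans_eq ?_
    simp [mul_comm]
  · congr 1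
    ring

omit [MeasurableSpace 𝒜] [MeasurableSingletonClass 𝒜] [Fintype 𝒜] [MeasurableSpace Ω] in
/-- The estimation error is paid for by the bonus and the deviations. -/
lemma rate_sub_ucb_mul_le {q : ℝ} (hq : q ∈ Set.Icc (0 : ℝ) 1) (k : Fin K) (t : ℕ) (ω : Ω) :
    (N.rate k - ucb N S A k t ω) * (q - N.I k (A t ω)) ≤
      (deviation N S A (-1) k t).indicator 1 ω + (deviation N S A 1 k t).indicator 1 ω
        + N.I k (A t ω) * bonus N S A k t ω := by
  have hI := N.I_mem k (A t ω)
  have hU1 := ucb_le_one (N := N) (S := S) (A := A) k t ω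
  have hU0 := ucb_nonneg (N := N) (S := S) (A := A) k t ω
  have hx0 := N.rate_nonneg k
  have hx1 := N.rate_le_one k
  have h1 : (N.rate k - ucb N S A k t ω) * q ≤
      (deviation N S A (-1) k t).indicator (1 : Ω → ℝ) ω := by
    by_cases h : ω ∈ deviation N S A (-1) k t
    · simp only [Set.indicator_of_mem h, Pi.one_apply]
      nlinarith [hq.1, hq.2]
    · rw [Set.indicator_of_notMem h]
      exact mul_nonpos_of_nonpos_of_nonneg (by linarith [rate_le_ucb k t ω h]) hq.1
  have h2 : N.I k (A t ω) * (ucb N S A k t ω - N.rate k) ≤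
      (deviation N S A 1 k t).indicator (1 : Ω → ℝ) ω + N.I k (A t ω) * bonus N S A k t ω := by
    rw [bonus]
    by_cases h : ω ∈ deviation N S A 1 k t
    · simp only [Set.indicator_of_mem h, Pi.one_apply, if_pos h, mul_zero, add_zero]
      nlinarith [hI.1, hI.2]
    · rw [Set.indicator_of_notMem h, if_neg h, zero_add]
  nlinarith

omit [MeasurableSpace 𝒜] [MeasurableSingletonClass 𝒜] [MeasurableSpace Ω] in
/-- A maximizing action is at least as good as any random one. -/
lemma sum_mul_average_le {w : 𝒜 → ℝ} (hw : w ∈ stdSimplex ℝ 𝒜) {c : Fin K → ℝ} {a : 𝒜}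
    (ha : ∀ b, ∑ k, c k * N.I k b ≤ ∑ k, c k * N.I k a) :
    ∑ k, c k * ∑ b, w b * N.I k b ≤ ∑ k, c k * N.I k a := by
  calc ∑ k, c k * ∑ b, w b * N.I k b = ∑ b, w b * ∑ k, c k * N.I k b := by
        simp_rw [Finset.mul_sum]
        rw [Finset.sum_comm]
        exact Finset.sum_congr rfl fun b _ => Finset.sum_congr rfl fun k _ => by ring
    _ ≤ ∑ b, w b * ∑ k, c k * N.I k a :=
        Finset.sum_le_sum fun b _ => mul_le_mul_of_nonneg_left (ha b) (hw.1 b)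
    _ = ∑ k, c k * N.I k a := by rw [← Finset.sum_mul, hw.2, one_mul]

/-- The regret against a static policy that has slack `ε` in all throughput requirements. -/
lemma sum_rate_mul_sub_le (run : IsAgeBasedRun N χ η ε T P S G A) (hη : 0 < η) (hT : 2 ≤ T)
    (hp : ∀ k, 0 < χ k + ε) (hp' : ∀ k, χ k + ε ≤ 1) (hx : ∀ k, 0 < N.rate k)
    {w : 𝒜 → ℝ} (hw : w ∈ stdSimplex ℝ 𝒜)
    (hq : ∀ k, χ k + ε ≤ N.rate k * ∑ a, w a * N.I k a) :
    ∑ k, ∑ t ∈ Finset.Icc 1 T,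
      (N.rate k * ∑ a, w a * N.I k a - ∫ ω, N.R k (S t ω) (A t ω) ∂P) ≤
      T / η * ∑ k, 1 / ((χ k + ε) * N.rate k)
        + Real.sqrt (56 * K * N.Imax * T * Real.log T) + K * Real.pi ^ 2 / 3 := by
  obtain ⟨hS, hG, hist, hmax⟩ := run
  set q : Fin K → ℝ := fun k => ∑ a, w a * N.I k a
  have hq01 : ∀ k, q k ∈ Set.Icc (0 : ℝ) 1 := fun k =>
    ⟨Finset.sum_nonneg fun a _ => mul_nonneg (hw.1 a) (N.I_mem k a).1, by
      rw [← hw.2]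
      exact Finset.sum_le_sum fun a _ => mul_le_of_le_one_right (hw.1 a) (N.I_mem k a).2⟩
  -- `F` is the scaled regret minus everything that is bounded only in expectation: the deviations
  -- and the excess age-weighted service. What remains can be bounded on each path.
  let F : Fin K → ℕ → Ω → ℝ := fun k t ω =>
    η * (N.rate k * (q k - N.I k (A t ω)))
      - η * ((deviation N S A (-1) k t).indicator 1 ω + (deviation N S A 1 k t).indicator 1 ω)
      - (age N S G A k t ω * N.I k (A t ω) - q k * age N S G A k t ω)
  have hpath : ∀ ω, ∑ k, ∑ t ∈ Finset.Icc 1 T, F k t ω ≤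
      η * Real.sqrt (56 * K * N.Imax * T * Real.log T) := by
    intro ω
    refine le_trans ?_ (mul_le_mul_of_nonneg_left (sum_bonus_run_le (N := N) (S := S) (A := A) hT ω)
      hη.le)
    rw [Finset.sum_comm, Finset.sum_comm (s := (Finset.univ : Finset (Fin K))), Finset.mul_sum]
    refine Finset.sum_le_sum fun t ht => ?_
    have h1 := sum_mul_average_le hw (hmax t ht ω)
    have h2 : ∀ k, F k t ω ≤ η * (N.I k (A t ω) * bonus N S A k t ω) +
        ((η * ucb N S A k t ω + age N S G A k t ω) * q k
          - (η * ucb N S A k t ω + age N S G A k t ω) * N.I k (A t ω)) := by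
      intro k
      have h3 := mul_le_mul_of_nonneg_left
        (rate_sub_ucb_mul_le (N := N) (S := S) (A := A) (hq01 k) k t ω) hη.le
      simp only [F]
      linarith
    refine (Finset.sum_le_sum fun k _ => h2 k).trans ?_
    rw [Finset.sum_add_distrib, Finset.sum_sub_distrib, ← Finset.mul_sum]
    linarith
  have hIi : ∀ k, ∀ t ∈ Finset.Icc 1 T, Integrable (fun ω => N.I k (A t ω)) P := fun k t ht => by
    rw [Finset.mem_Icc] at ht
    refine integrable_of_abs_le ((measurable_of_finite (N.I k)).comp
      (measurable_action hS hG hist ht.1 ht.2)) 1 fun ω => ?_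
    have h := N.I_mem k (A t ω)
    rw [abs_of_nonneg h.1]
    exact h.2
  have hDi : ∀ σ k, ∀ t ∈ Finset.Icc 1 T,
      Integrable ((deviation N S A σ k t).indicator (1 : Ω → ℝ)) P := fun σ k t ht =>
    (integrable_const (1 : ℝ)).indicator
      (measurableSet_deviation hS hG hist σ k (by rw [Finset.mem_Icc] at ht; omega))
  have hFi : ∀ k, ∀ t ∈ Finset.Icc 1 T, Integrable (F k t) P ∧ ∫ ω, F k t ω ∂P =
      η * (N.rate k * q k - ∫ ω, N.R k (S t ω) (A t ω) ∂P)
        - η * (P.real (deviation N S A (-1) k t) + P.real (deviation N S A 1 k t))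
        - (∫ ω, (age N S G A k t ω : ℝ) * N.I k (A t ω) ∂P
          - q k * ∫ ω, (age N S G A k t ω : ℝ) ∂P) := by
    intro k t ht
    have ht' := Finset.mem_Icc.1 ht
    have hZ := integrable_age hS hG hist k ht'.1 (by omega)
    have hZI := integrable_age_mul_I hS hG hist k ht'.1 ht'.2
    have hD : ∀ σ, ∫ ω, (deviation N S A σ k t).indicator (1 : Ω → ℝ) ω ∂P =
        P.real (deviation N S A σ k t) := fun σ =>
      integral_indicator_one (measurableSet_deviation hS hG hist σ k (by omega))
    have i1 : Integrable (fun ω => η * (N.rate k * (q k - N.I k (A t ω)))) P :=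
      (((integrable_const (q k)).sub (hIi k t ht)).const_mul _).const_mul _
    have i2 : Integrable (fun ω => η * ((deviation N S A (-1) k t).indicator (1 : Ω → ℝ) ω +
        (deviation N S A 1 k t).indicator (1 : Ω → ℝ) ω)) P :=
      ((hDi _ k t ht).add (hDi _ k t ht)).const_mul _
    have i3 : Integrable (fun ω => (age N S G A k t ω : ℝ) * N.I k (A t ω)
        - q k * age N S G A k t ω) P := hZI.sub (hZ.const_mul _)
    have i12 : Integrable (fun ω => η * (N.rate k * (q k - N.I k (A t ω))) -
        η * ((deviation N S A (-1) k t).indicator (1 : Ω → ℝ) ω +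
        (deviation N S A 1 k t).indicator (1 : Ω → ℝ) ω)) P := i1.sub i2
    refine ⟨i12.sub i3, ?_⟩
    simp only [F]
    rw [integral_sub i12 i3, integral_sub i1 i2, integral_sub hZI (hZ.const_mul _),
      integral_const_mul, integral_const_mul, integral_const_mul, integral_const_mul,
      integral_sub (integrable_const _) (hIi k t ht),
      integral_add (hDi _ k t ht) (hDi _ k t ht), hD, hD,
      integral_reward hS hG hist k ht'.1 ht'.2, integral_const, probReal_univ, one_smul, mul_sub]
  have hint : ∑ k, ∑ t ∈ Finset.Icc 1 T, ∫ ω, F k t ω ∂P ≤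
      η * Real.sqrt (56 * K * N.Imax * T * Real.log T) := by
    have h : ∫ ω, ∑ k, ∑ t ∈ Finset.Icc 1 T, F k t ω ∂P ≤
        ∫ _ω, η * Real.sqrt (56 * K * N.Imax * T * Real.log T) ∂P :=
      integral_mono (integrable_finsetSum _ fun k _ => integrable_finsetSum _ fun t ht =>
        (hFi k t ht).1) (integrable_const _) hpath
    rw [integral_const, probReal_univ, one_smul, integral_finsetSum _ fun k _ =>
      integrable_finsetSum _ fun t ht => (hFi k t ht).1] at h
    refine le_trans (le_of_eq (Finset.sum_congr rfl fun k _ => ?_)) h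
    rw [integral_finsetSum _ fun t ht => (hFi k t ht).1]
  have hnode : ∀ k, η * ∑ t ∈ Finset.Icc 1 T,
        (N.rate k * q k - ∫ ω, N.R k (S t ω) (A t ω) ∂P) ≤
      ∑ t ∈ Finset.Icc 1 T, ∫ ω, F k t ω ∂P + η * (Real.pi ^ 2 / 3)
        + T * (1 / ((χ k + ε) * N.rate k)) := by
    intro k
    have h1 := sum_measureReal_deviation_le hS hG hist (σ := -1) (by norm_num) k
    have h2 := sum_measureReal_deviation_le hS hG hist (σ := 1) (by norm_num) k
    have h3 := sum_integral_age_mul_le hS hG hist k (hp k) (hp' k) (hx k)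
    -- The slack of `w` enters here: `q k` is at least the arrival rate divided by the channel rate,
    -- so the linear age terms cancel.
    have h4 : (χ k + ε) / N.rate k * ∑ t ∈ Finset.Icc 1 T, ∫ ω, (age N S G A k t ω : ℝ) ∂P ≤
        q k * ∑ t ∈ Finset.Icc 1 T, ∫ ω, (age N S G A k t ω : ℝ) ∂P := by
      refine mul_le_mul_of_nonneg_right ?_ (Finset.sum_nonneg fun t _ =>
        integral_nonneg fun ω => Nat.cast_nonneg _)
      rw [div_le_iff₀ (hx k), mul_comm]
      exact hq k
    have e : ∑ t ∈ Finset.Icc 1 T, ∫ ω, F k t ω ∂P =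
        η * ∑ t ∈ Finset.Icc 1 T, (N.rate k * q k - ∫ ω, N.R k (S t ω) (A t ω) ∂P)
          - η * (∑ t ∈ Finset.Icc 1 T, P.real (deviation N S A (-1) k t) +
            ∑ t ∈ Finset.Icc 1 T, P.real (deviation N S A 1 k t))
          - (∑ t ∈ Finset.Icc 1 T, ∫ ω, (age N S G A k t ω : ℝ) * N.I k (A t ω) ∂P
            - q k * ∑ t ∈ Finset.Icc 1 T, ∫ ω, (age N S G A k t ω : ℝ) ∂P) := by
      rw [Finset.sum_congr rfl fun t ht => (hFi k t ht).2]
      simp only [Finset.sum_sub_distrib, ← Finset.mul_sum, Finset.sum_add_distrib]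
    rw [e]
    have h5 := mul_le_mul_of_nonneg_left (add_le_add h1 h2) hη.le
    rw [mul_one_div]
    linarith
  have htot := Finset.sum_le_sum fun k (_ : k ∈ Finset.univ) => hnode k
  rw [← Finset.mul_sum, Finset.sum_add_distrib, Finset.sum_add_distrib, ← Finset.mul_sum,
    ← Finset.mul_sum, Finset.sum_const, Finset.card_univ, Fintype.card_fin, nsmul_eq_mul] at htot
  refine le_of_mul_le_mul_left (htot.trans ?_) hη
  have : η * (T / η * ∑ k, 1 / ((χ k + ε) * N.rate k)) =
      T * ∑ k, 1 / ((χ k + ε) * N.rate k) := by field_simp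
  linarith

end Regret

/-! ### Order of growth of the bound. -/

section Bound

variable {K : ℕ} {𝒮 𝒜 : Type u} [MeasurableSpace 𝒮] {N : Network K 𝒮 𝒜} {χ : Fin K → ℝ}
  {η ε γ : ℝ} {T : ℕ}

lemma sum_one_div_nonneg (N : Network K 𝒮 𝒜) (hχ : ∀ k, 0 < χ k) :
    0 ≤ ∑ k, 1 / (χ k * N.rate k) :=
  Finset.sum_nonneg fun k _ => one_div_nonneg.2 (mul_nonneg (hχ k).le (N.rate_nonneg k))

/-- The order of growth of the regret bound. -/
lemma exists_regretBound_le (N : Network K 𝒮 𝒜) (hχ : ∀ k, 0 < χ k) (hγ : 0 < γ) :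
    ∃ C : ℝ, ∀ (T : ℕ) (η ε : ℝ), 2 ≤ T → 0 < η → 0 < ε →
      regretBound N χ γ η ε T ≤ C * (ε * T + T / η + Real.sqrt (T * Real.log T)) := by
  refine ⟨K / γ + ∑ k, 1 / (χ k * N.rate k) + Real.sqrt (56 * K * N.Imax) + K * Real.pi ^ 2 / 3,
    fun T η ε hT hη hε => ?_⟩
  have hT' : (2 : ℝ) ≤ T := by exact_mod_cast hT
  -- This lets the constant term be absorbed; it holds since `2 log 2 > 1`.
  have hone : 1 ≤ Real.sqrt (T * Real.log T) := by
    refine Real.le_sqrt_of_sq_le ?_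
    have h1 := Real.log_two_gt_d9
    have h2 := Real.log_le_log (by norm_num) hT'
    nlinarith
  have hIm : 0 ≤ 56 * K * N.Imax :=
    mul_nonneg (by positivity) N.Imax_nonneg
  have hs : Real.sqrt (56 * K * N.Imax * T * Real.log T) =
      Real.sqrt (56 * K * N.Imax) * Real.sqrt (T * Real.log T) := by
    rw [← Real.sqrt_mul hIm, mul_assoc (56 * K * N.Imax)]
  have h1 := sum_one_div_nonneg N hχ
  have h2 : ε * K * T / γ = K / γ * (ε * T) := by ring
  have h3 : (0 : ℝ) ≤ K / γ := by positivity
  have h4 : 0 ≤ ε * T := by positivity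
  have h5 : 0 ≤ T / η := by positivity
  have h6 := Real.sqrt_nonneg (56 * K * N.Imax)
  have h7 : 0 ≤ K * Real.pi ^ 2 / 3 := by positivity
  rw [regretBound, hs, h2]
  have e : ∀ a b c d x y z : ℝ, 0 ≤ a → 0 ≤ b → 0 ≤ c → 0 ≤ d → 0 ≤ x → 0 ≤ y → 1 ≤ z →
      a * x + y * b + c * z + d ≤ (a + b + c + d) * (x + y + z) := by
    intro a b c d x y z ha hb hc hd hx hy hz
    have := mul_nonneg ha hy
    have := mul_nonneg ha (zero_le_one.trans hz)
    have := mul_nonneg hb hx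
    have := mul_nonneg hb (zero_le_one.trans hz)
    have := mul_nonneg hc hx
    have := mul_nonneg hc hy
    have := mul_nonneg hd hx
    have := mul_nonneg hd hy
    have := mul_le_mul_of_nonneg_left hz hd
    linarith
  exact e _ _ _ _ _ _ _ h3 h1 h6 h7 h4 h5 hone

end Bound

/-! ### Passing from the slack policy to the benchmark. -/

section Main

variable {K : ℕ} {𝒮 𝒜 : Type u} [MeasurableSpace 𝒮] [MeasurableSpace 𝒜]
  [MeasurableSingletonClass 𝒜] [Fintype 𝒜] {N : Network K 𝒮 𝒜} {T : ℕ} {χ : Fin K → ℝ}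
  {η ε γ : ℝ} {Ω : Type v} [MeasurableSpace Ω] {P : Measure Ω} [IsProbabilityMeasure P]
  {S : ℕ → Ω → 𝒮} {G : Fin K → ℕ → Ω → ℕ} {A : ℕ → Ω → 𝒜}

lemma staticThroughput_le_rate (N : Network K 𝒮 𝒜) (σ : PMF 𝒜) (k : Fin K) :
    N.staticThroughput σ k ≤ N.rate k := by
  rw [staticThroughput_eq]
  refine mul_le_of_le_one_right (N.rate_nonneg k) ?_
  rw [← sum_toReal_eq_one σ]
  exact Finset.sum_le_sum fun a _ => mul_le_of_le_one_right ENNReal.toReal_nonneg (N.I_mem k a).2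

theorem regret_le_regretBound (hχ : ∀ k, 0 < χ k) (hγ : 0 < γ) {σγ σ : PMF 𝒜}
    (slater : ∀ k, χ k + γ ≤ N.staticThroughput σγ k) (hσ : ∀ k, χ k ≤ N.staticThroughput σ k)
    (hη : 0 < η) (hε : 0 < ε) (hεγ : ε ≤ γ / 2) (hT : 1 ≤ T)
    (run : IsAgeBasedRun N χ η ε T P S G A) :
    regret N P S A σ T ≤ regretBound N χ γ η ε T := by
  have hrate : ∀ k, χ k + γ ≤ N.rate k := fun k =>
    (slater k).trans (staticThroughput_le_rate N σγ k)
  have hx : ∀ k, 0 < N.rate k := fun k => by linarith [hrate k, hχ k]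
  have hsum := sum_one_div_nonneg N hχ
  rcases hT.lt_or_eq with hT2 | rfl
  -- This mixing weight turns the slack `γ` of the Slater policy into exactly `ε`.
  · set δ := ε / γ with hδ
    have hδ0 : 0 ≤ δ := by positivity
    have hδ1 : δ ≤ 1 := (div_le_one hγ).2 (by linarith)
    have hδγ : δ * γ = ε := div_mul_cancel₀ _ hγ.ne'
    let w : 𝒜 → ℝ := fun a => (1 - δ) * (σ a).toReal + δ * (σγ a).toReal
    have hw : w ∈ stdSimplex ℝ 𝒜 := by
      refine ⟨fun a => add_nonneg (mul_nonneg (by linarith) ENNReal.toReal_nonneg)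
        (mul_nonneg hδ0 ENNReal.toReal_nonneg), ?_⟩
      simp only [w]
      rw [Finset.sum_add_distrib, ← Finset.mul_sum, ← Finset.mul_sum, sum_toReal_eq_one,
        sum_toReal_eq_one]
      ring
    have hwq : ∀ k, N.rate k * ∑ a, w a * N.I k a =
        (1 - δ) * N.staticThroughput σ k + δ * N.staticThroughput σγ k := by
      intro k
      rw [staticThroughput_eq, staticThroughput_eq]
      simp only [w, add_mul, mul_assoc]
      rw [Finset.sum_add_distrib, ← Finset.mul_sum, ← Finset.mul_sum]
      ring
    have hmain := sum_rate_mul_sub_le run hη hT2 (fun k => by linarith [hχ k])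
      -- `χ k + ε` is a legitimate geometric parameter, because `χ k + γ ≤ N.rate k ≤ 1`.
      (fun k => by linarith [hrate k, N.rate_le_one k]) hx hw (fun k => by
        rw [hwq]
        have h1 := mul_le_mul_of_nonneg_left (hσ k) (sub_nonneg.2 hδ1)
        have h2 := mul_le_mul_of_nonneg_left (slater k) hδ0
        linarith)
    have hcmp : regret N P S A σ T ≤ ∑ k, ∑ t ∈ Finset.Icc 1 T,
        (N.rate k * ∑ a, w a * N.I k a - ∫ ω, N.R k (S t ω) (A t ω) ∂P) + ε * K * T / γ := by
      have e : ε * K * T / γ = ∑ _k : Fin K, ∑ _t ∈ Finset.Icc 1 T, δ := by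
        simp [hδ]
        ring
      rw [e, ← Finset.sum_add_distrib]
      refine Finset.sum_le_sum fun k _ => ?_
      rw [← Finset.sum_add_distrib]
      refine Finset.sum_le_sum fun t _ => ?_
      rw [hwq]
      have h1 := staticThroughput_le_rate N σ k
      have h2 := N.rate_le_one k
      have h3 := mul_nonneg hδ0 (show 0 ≤ N.staticThroughput σγ k by linarith [slater k, hχ k])
      have h4 := mul_le_mul_of_nonneg_left (h1.trans h2) hδ0
      linarith
    have hle : T / η * ∑ k, 1 / ((χ k + ε) * N.rate k) ≤ T / η * ∑ k, 1 / (χ k * N.rate k) := by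
      refine mul_le_mul_of_nonneg_left (Finset.sum_le_sum fun k _ => ?_) (by positivity)
      exact one_div_le_one_div_of_le (mul_pos (hχ k) (hx k))
        (mul_le_mul_of_nonneg_right (by linarith) (hx k).le)
    rw [regretBound]
    linarith
  -- For `T = 1` the logarithm vanishes, so the bonus estimate is unavailable; the trivial bound `K`
  -- is covered by `Kπ²/3`.
  · have h1 : regret N P S A σ 1 ≤ K := by
      rw [regret]
      refine (Finset.sum_le_sum fun k _ => (?_ : _ ≤ (1 : ℝ))).trans_eq (by simp)
      rw [Finset.Icc_self, Finset.sum_singleton]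
      have h2 : 0 ≤ ∫ ω, N.R k (S 1 ω) (A 1 ω) ∂P := integral_nonneg fun ω => by
        rcases N.R_eq_zero_or_one k (S 1 ω) (A 1 ω) with h | h <;> simp [h]
      linarith [staticThroughput_le_rate N σ k, N.rate_le_one k]
    have h2 : (K : ℝ) ≤ K * Real.pi ^ 2 / 3 := by
      have h3 : (0 : ℝ) ≤ K := Nat.cast_nonneg _
      have h4 := Real.pi_gt_three
      have h5 : (3 : ℝ) ≤ Real.pi ^ 2 := by nlinarith
      nlinarith
    have h3 : 0 ≤ ε * K * (1 : ℕ) / γ := by positivity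
    have h4 : 0 ≤ ((1 : ℕ) : ℝ) / η * ∑ k, 1 / (χ k * N.rate k) := mul_nonneg (by positivity) hsum
    have h5 := Real.sqrt_nonneg (56 * K * N.Imax * (1 : ℕ) * Real.log (1 : ℕ))
    exact h1.trans (h2.trans (le_add_of_nonneg_left (add_nonneg (add_nonneg h3 h4) h5)))

end Main

end AgeBandit

theorem mainTheorem3 {K : ℕ} {𝒮 𝒜 : Type u} [MeasurableSpace 𝒮] [MeasurableSpace 𝒜]
    [MeasurableSingletonClass 𝒜] [Fintype 𝒜] (N : AgeBandit.Network K 𝒮 𝒜)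
    (χ : Fin K → ℝ) (hχ : ∀ k, 0 < χ k) (γ : ℝ) (hγ : 0 < γ)
    (slater : ∃ σγ : PMF 𝒜, ∀ k, χ k + γ ≤ N.rate k * ∫ a, N.I k a ∂σγ.toMeasure) :
    (∀ T W : ℕ, 1 ≤ T → 1 ≤ W → W ∣ T →
      (∃ σ : PMF 𝒜, AgeBandit.IsOptimalStatic N χ T W σ) ∧
      ∀ σ : PMF 𝒜, AgeBandit.IsOptimalStatic N χ T W σ →
        ∀ η ε : ℝ, 0 < η → 0 < ε → ε ≤ γ / 2 →
          ∀ (Ω : Type v) [MeasurableSpace Ω] (P : MeasureTheory.Measure Ω)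
            [MeasureTheory.IsProbabilityMeasure P] (S : ℕ → Ω → 𝒮) (G : Fin K → ℕ → Ω → ℕ)
            (A : ℕ → Ω → 𝒜), AgeBandit.IsAgeBasedRun N χ η ε T P S G A →
            AgeBandit.regret N P S A σ T ≤ AgeBandit.regretBound N χ γ η ε T) ∧
    ∃ C : ℝ, ∀ (T : ℕ) (η ε : ℝ), 2 ≤ T → 0 < η → 0 < ε →
      AgeBandit.regretBound N χ γ η ε T ≤
        C * (ε * T + T / η + Real.sqrt (T * Real.log T)) := by
  obtain ⟨σγ, hσγ⟩ := slater
  have hs : ∀ k, χ k + γ ≤ N.staticThroughput σγ k := fun k => by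
    rw [AgeBandit.staticThroughput_eq]
    refine (hσγ k).trans_eq ?_
    rw [PMF.integral_eq_sum]
    rfl
  refine ⟨fun T W hT hW hWT => ⟨?_, ?_⟩, AgeBandit.exists_regretBound_le N hχ hγ⟩
  · exact AgeBandit.exists_isOptimalStatic hT hW hWT ⟨σγ, fun k => by linarith [hs k]⟩
  · intro σ hσ η ε hη hε hεγ Ω _ P _ S G A run
    exact AgeBandit.regret_le_regretBound hχ hγ hs (AgeBandit.le_staticThroughput hT hW hWT hσ)
      hη hε hεγ hT run
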